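/- Let $\mathfrak H$ be the upper half-plane and $\Gamma_1=\mathrm{SL}_2(\mathbb Z)$. For a lattice $L=[\omega_1,\omega_2]=\mathbb Z\omega_1+\mathbb Z\omega_2\subset\mathbb C$ put $$\sigma(z,L)=z\prod_{\omega\in L\setminus\{0\}}\Bigl(1-\frac z\omega\Bigr)e^{z/\omega+(z/\omega)^2/2},\qquad \zeta(z,L)=\frac{\sigma'(z,L)}{\sigma(z,L)},$$ let $\eta(\omega,L)$, for $\omega\in L$, be the constant with $\zeta(z+\omega,L)=\zeta(z,L)+\eta(\omega,L)$ for all $z\notin L$, and extend it to $\mathbb C$ by $\eta(r_1\omega_1+r_2\omega_2,L)=r_1\eta(\omega_1,L)+r_2\eta(\omega_2,L)$ for $r_1,r_2\in\mathbb R$. Let $\psi(z,L)=-1$ if $z\in L\setminus 2L$ and $\psi(z,L)=1$ otherwise. For $\tau\in\mathfrak H$, $z\in\mathbb C$ put $q=e^{2\pi i\tau}$, $\zeta=e^{2\pi iz}$, $\rho(\tau,z)=\exp(\tfrac12\eta(1,[\tau,1])z^2-\pi iz)$. For $k\in\mathbb Z$ and $\phi:\mathfrak H\times\mathbb C\to\mathbb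 C$ define $$(\phi|'_kM)(\tau,z)=(c\tau+d)^{-k}\phi\Bigl(\frac{a\tau+b}{c\tau+d},\frac z{c\tau+d}\Bigr),\qquad M=\begin{pmatrix}a&b\\c&d\end{pmatrix}\in\mathrm{SL}_2(\mathbb R),$$ $$(\phi|''_k[\lambda\ \mu])(\tau,z)=\Bigl(\psi(\lambda\tau+\mu,[\tau,1])\exp\bigl(\eta(\lambda\tau+\mu,[\tau,1])(z+\tfrac12(\lambda\tau+\mu))\bigr)\Bigr)^k\phi(\tau,z+\lambda\tau+\mu),\qquad(\lambda,\mu)\in\mathbb R^2.$$ For a subgroup $\Gamma\subset\Gamma_1$ of finite index, $J_k(\Gamma)$ is the set of modified Jacobi forms of weight $k$ and index $0$ on $\Gamma$: the holomorphic functions $\phi$ on $\mathfrak H\times\mathbb C$ such that (i) $\phi|'_kM=\phi$ for all $M\in\Gamma$; (ii) $\phi|''_kX=\phi$ for all $X\in\mathbb Z^2$; (iii) for each $M\in\Gamma_1$ the function $\rho^k(\phi|'_kM)$ has an absolutely convergent Fourier development $\sum_{n\ge0}\sum_{|r|\le r_0(n)}c(n,r)q^n\zeta^r$ for some (weakly)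 increasing sequence $(r_0(n))_{n\ge 0}$ of nonnegative integers with $r_0(n)/n\to0$. Theorem. For every $\tau\in\mathfrak H$ the product defining $\sigma(z,[\tau,1])$ converges for all $z\in\mathbb C$, and $\zeta(z+\omega,[\tau,1])=\zeta(z,[\tau,1])+\eta(\omega,[\tau,1])$ for all $\omega\in[\tau,1]$ and $z\notin[\tau,1]$. The function $\sigma(\tau,z):=\sigma(z,[\tau,1])$ belongs to $J_{-1}(\Gamma_1)$. Consequently the Klein forms $$\mathfrak k_{(\lambda,\mu)}(\tau)=\psi(\lambda\tau+\mu,[\tau,1])\exp\bigl(-\tfrac12\eta(\lambda\tau+\mu,[\tau,1])(\lambda\tau+\mu)\bigr)\sigma(\tau,\lambda\tau+\mu)$$ are its specializations: $\mathfrak k_{(\lambda,\mu)}(\tau)=(\sigma|''_{-1}[\lambda\ \mu])(\tau,0)$ for all $(\lambda,\mu)\in\mathbb R^2$; and if $(\lambda,\mu)\in N^{-1}\mathbb Z^2$ for an integer $N\ge1$, then $\mathfrak k_{(\lambda,\mu)}$ is a nearly holomorphic modular form (holomorphic on $\mathfrak H$ and meromorphic at every cusp) of weight $-1$ on the principal congruence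 subgroup $\Gamma(2N^2)$. -/

import Mathlib

open scoped UpperHalfPlane MatrixGroups ModularForm Manifold

noncomputable section

namespace ModifiedJacobi

/-- The `ω`-factor `(1 - z/ω) exp(z/ω + (z/ω)²/2)` of the Weierstrass product. -/
def sigmaFactor (z ω : ℂ) : ℂ :=
  (1 - z / ω) * Complex.exp (z / ω + (z / ω) ^ 2 / 2)

/-- The Weierstrass `σ`-function `σ(z, Λ)` of a lattice `Λ`. -/
def weierstrassSigma (Λ : Submodule ℤ ℂ) (z : ℂ) : ℂ :=
  z * ∏' ω : ↥((Λ : Set ℂ) \ {0}), sigmaFactor z ω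

/-- The Weierstrass `ζ`-function `ζ(z, Λ) = σ'(z, Λ) / σ(z, Λ)`. -/
def weierstrassZeta (Λ : Submodule ℤ ℂ) (z : ℂ) : ℂ :=
  deriv (weierstrassSigma Λ) z / weierstrassSigma Λ z

/-- For `ω ∈ Λ`, the constant `η(ω, Λ)` with `ζ(z + ω, Λ) = ζ(z, Λ) + η(ω, Λ)` for all `z ∉ Λ`. -/
def quasiPeriod (Λ : Submodule ℤ ℂ) (ω : ℂ) : ℂ :=
  Classical.epsilon fun c : ℂ =>
    ∀ z : ℂ, z ∉ Λ → weierstrassZeta Λ (z + ω) = weierstrassZeta Λ z + c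

/-- The Weierstrass `η`-function: the `ℝ`-linear extension of `ω ↦ η(ω, [ω₁, ω₂])` to `ℂ`, that is
`η(r₁ω₁ + r₂ω₂) = r₁ η(ω₁) + r₂ η(ω₂)`. -/
def weierstrassEta (L : PeriodPair) (z : ℂ) : ℂ :=
  (L.basis.repr z 0 : ℂ) * quasiPeriod L.lattice L.ω₁ +
    (L.basis.repr z 1 : ℂ) * quasiPeriod L.lattice L.ω₂

open Classical in
/-- `ψ(z, Λ)` is `-1` if `z ∈ Λ ∖ 2Λ` and `1` otherwise. -/
def psi (Λ : Submodule ℤ ℂ) (z : ℂ) : ℂ :=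
  if z ∈ Λ ∧ ¬ ∃ w ∈ Λ, z = 2 * w then -1 else 1

/-- The periods `τ, 1`, spanning the lattice `[τ, 1]`. -/
def periods (τ : ℍ) : PeriodPair where
  ω₁ := τ
  ω₂ := 1
  indep := by
    rw [LinearIndependent.pair_iff]
    intro s t h
    have h1 := congrArg Complex.im h
    have h2 := congrArg Complex.re h
    simp [τ.im_ne_zero] at h1
    subst h1
    simp at h2
    exact ⟨rfl, h2⟩

/-- `σ(τ, z) = σ(z, [τ, 1])`. -/
def sigma (τ : ℍ) (z : ℂ) : ℂ :=
  weierstrassSigma (periods τ).lattice z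

/-- `ρ(τ, z) = exp(½ η(1, [τ, 1]) z² - π i z)`. -/
def rho (τ : ℍ) (z : ℂ) : ℂ :=
  Complex.exp (1 / 2 * weierstrassEta (periods τ) 1 * z ^ 2 - Real.pi * Complex.I * z)

/-- The operator `φ |'_k M`, i.e. the index-zero Jacobi slash operator
`(cτ + d)^(-k) φ((aτ + b)/(cτ + d), z/(cτ + d))`. -/
def slash' (k : ℤ) (φ : ℍ → ℂ → ℂ) (M : SL(2, ℝ)) (τ : ℍ) (z : ℂ) : ℂ :=
  ((M 1 0 : ℂ) * τ + (M 1 1 : ℂ)) ^ (-k) * φ (M • τ) (z / ((M 1 0 : ℂ) * τ + (M 1 1 : ℂ)))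

/-- The operator `φ |''_k [a b]` for `(a, b) ∈ ℝ²`. -/
def slash'' (k : ℤ) (φ : ℍ → ℂ → ℂ) (a b : ℝ) (τ : ℍ) (z : ℂ) : ℂ :=
  (psi (periods τ).lattice (a * τ + b) *
      Complex.exp (weierstrassEta (periods τ) (a * τ + b) * (z + 1 / 2 * (a * τ + b)))) ^ k *
    φ τ (z + (a * τ + b))

/-- Joint holomorphy of a function on `ℍ × ℂ`. -/
def IsHolomorphic (φ : ℍ → ℂ → ℂ) : Prop :=
  DifferentiableOn ℂ (fun p : ℂ × ℂ => φ (UpperHalfPlane.ofComplex p.1) p.2)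
    {p : ℂ × ℂ | 0 < p.1.im}

/-- `f` has an (absolutely convergent) Fourier development
`∑_{n ≥ 0} ∑_{|r| ≤ r₀(n)} c(n, r) qⁿ ζʳ`, where `r₀` is an increasing sequence of nonnegative
integers with `r₀(n) / n → 0`, and `q = exp(2πiτ)`, `ζ = exp(2πiz)`. -/
def HasFourierDevelopment (f : ℍ → ℂ → ℂ) : Prop :=
  ∃ (r₀ : ℕ → ℕ) (c : ℕ → ℤ → ℂ),
    Monotone r₀ ∧
    Filter.Tendsto (fun n : ℕ => (r₀ n : ℝ) / (n : ℝ)) Filter.atTop (nhds 0) ∧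
    (∀ (n : ℕ) (r : ℤ), (r₀ n : ℤ) < |r| → c n r = 0) ∧
    ∀ (τ : ℍ) (z : ℂ),
      HasSum
        (fun p : ℕ × ℤ => c p.1 p.2 * Complex.exp (2 * Real.pi * Complex.I * τ) ^ p.1 *
          Complex.exp (2 * Real.pi * Complex.I * z) ^ p.2)
        (f τ z)

/-- Modified Jacobi forms of weight `k` and index `0` on a finite-index subgroup `Γ` of
`SL₂(ℤ)`. -/
structure IsModifiedJacobiForm (k : ℤ) (Γ : Subgroup SL(2, ℤ)) [Γ.FiniteIndex]
    (φ : ℍ → ℂ → ℂ) : Prop where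
  holomorphic : IsHolomorphic φ
  slash'_eq : ∀ M ∈ Γ, slash' k φ (M : SL(2, ℝ)) = φ
  slash''_eq : ∀ a b : ℤ, slash'' k φ a b = φ
  fourier : ∀ M : SL(2, ℤ),
    HasFourierDevelopment fun τ z => rho τ z ^ k * slash' k φ (M : SL(2, ℝ)) τ z

/-- The set `J_k(Γ)` of modified Jacobi forms. -/
def J (k : ℤ) (Γ : Subgroup SL(2, ℤ)) [Γ.FiniteIndex] : Set (ℍ → ℂ → ℂ) :=
  {φ | IsModifiedJacobiForm k Γ φ}

/-- The Klein form
`𝔨_(a,b)(τ) = ψ(a, b) exp(-½ η(aτ + b, [τ, 1]) (aτ + b)) σ(τ, aτ + b)`. -/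
def kleinForm (a b : ℝ) (τ : ℍ) : ℂ :=
  psi (periods τ).lattice (a * τ + b) *
    Complex.exp (-(1 / 2) * weierstrassEta (periods τ) (a * τ + b) * (a * τ + b)) *
    sigma τ (a * τ + b)

/-- Nearly holomorphic modular forms of weight `k` on `Γ`: holomorphic on `ℍ`, invariant under the
weight-`k` slash action of `Γ`, and meromorphic at every cusp, i.e. each `f ∣[k] M` with
`M ∈ SL₂(ℤ)` is a Laurent series in `exp(2πiτ/h)` with finite principal part, for some `h ≥ 1`. -/
structure IsNearlyHolomorphicModularForm (k : ℤ) (Γ : Subgroup SL(2, ℤ)) (f : ℍ → ℂ) :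
    Prop where
  holomorphic : MDifferentiable 𝓘(ℂ) 𝓘(ℂ) f
  slash_eq : ∀ M ∈ Γ, f ∣[k] M = f
  meromorphic_at_cusps : ∀ M : SL(2, ℤ), ∃ (h : ℕ) (m : ℤ) (a : ℕ → ℂ), 0 < h ∧
    ∀ τ : ℍ,
      HasSum (fun n : ℕ => a n * Complex.exp (2 * Real.pi * Complex.I * τ / h) ^ (m + n : ℤ))
        ((f ∣[k] M) τ)

end ModifiedJacobi

end

/-! Each factor of the product is `1 + O(|z/ω|³)` and `∑ |ω|⁻³` converges, so `σ` is entire and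
vanishes exactly on the lattice. Its logarithmic derivative has derivative `-℘`; periodicity of `℘`
makes that logarithmic derivative additively quasi-periodic, and integrating once more, with the
constant fixed by oddness of `σ`, gives `weierstrassSigma_add`, which is condition (ii). Condition
(i) is homogeneity of `σ`, because `(cτ + d)[Mτ, 1] = [τ, 1]`; it also reduces (iii) at every cusp
to the case `M = 1`.

The analytic core is `ρ⁻¹σ = θ/θ'(0)` (`deriv_theta_mul_sigmaPeriodic`), where `θ = ∑ (-1)ʳ
q^(r(r-1)/2) e^(2πirz)`. The quotient `H` of `θ` by `ρ⁻¹σ` is entire, and its multipliers depend on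
the integer `k` with `η(τ) - η(1)τ = 2πik`. If `k ≠ -1`, a suitable product with a power of `θ` is
entire with constant multipliers and a zero at `0`, hence identically zero, which is absurd. So `k =
-1` (`legendre_relation`) and `H` is constant. As a function of `q`, `θ'(0)` has no zero in the unit
disc, so its inverse is a power series in `q`; multiplying by the theta series leaves only `|r| =
O(√n)`. The same identity yields joint holomorphy, once `η(1)` is known to be holomorphic in `τ`.

For Klein forms, homogeneity turns the slash action of `M` into `(a, b) ↦ (a, b)M`, and translation
by an even vector `2(m, n)` costs the factor `exp(2πi(an - bm))` (`kleinForm_add_even`). Laurent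
expansions at the cusps come from putting `z = aτ + b` in the Fourier development, where `r₀(n) =
o(n)` bounds the exponents below. -/

noncomputable section

namespace ModifiedJacobi

open Complex Filter Topology Set

/-! ### The Weierstrass product and the series for its logarithmic derivative -/

section Sigma

/-- Since `z / 0 = 0`, products may run over the whole lattice instead of its nonzero elements. -/
lemma sigmaFactor_zero_right (z : ℂ) : sigmaFactor z 0 = 1 := by simp [sigmaFactor]

lemma hasDerivAt_elementaryFactor (w : ℂ) :
    HasDerivAt (fun w : ℂ => (1 - w) * exp (w + w ^ 2 / 2)) (-w ^ 2 * exp (w + w ^ 2 / 2)) w := by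
  have h1 : HasDerivAt (fun w : ℂ => w + w ^ 2 / 2) (1 + w) w := by
    exact ((hasDerivAt_id w).add ((hasDerivAt_pow 2 w).div_const 2)).congr_deriv (by simp)
  refine (((hasDerivAt_id w).const_sub 1).mul h1.cexp).congr_deriv ?_
  simp only [id]
  ring

/-- The derivative is `-w² exp(w + w²/2)`, quadratically small at `0`, so the mean value inequality
on the disc of radius `‖w‖` gains a third power. -/
lemma norm_elementaryFactor_sub_one_le {w : ℂ} (hw : ‖w‖ ≤ 1) :
    ‖(1 - w) * exp (w + w ^ 2 / 2) - 1‖ ≤ Real.exp 2 * ‖w‖ ^ 3 := by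
  have key := (convex_closedBall (0 : ℂ) ‖w‖).norm_image_sub_le_of_norm_hasDerivWithin_le
    (f := fun w : ℂ => (1 - w) * exp (w + w ^ 2 / 2)) (C := ‖w‖ ^ 2 * Real.exp 2)
    (fun x _ => (hasDerivAt_elementaryFactor x).hasDerivWithinAt) (fun x hx => ?_)
    (x := 0) (y := w) (by simp) (by simp)
  · simp only [sub_zero, zero_pow two_ne_zero, zero_div, add_zero, exp_zero, mul_one] at key
    calc _ ≤ _ := key
      _ = _ := by ring
  · have hx' : ‖x‖ ≤ ‖w‖ := by simpa using hx
    rw [norm_mul, norm_neg, norm_pow]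
    gcongr
    rw [norm_exp]
    refine Real.exp_le_exp.2 ((re_le_norm _).trans ((norm_add_le _ _).trans ?_))
    have h1 : ‖x‖ ≤ 1 := hx'.trans hw
    have h2 : ‖x ^ 2 / 2‖ ≤ 1 := by
      rw [norm_div, norm_pow]
      have : ‖x‖ ^ 2 ≤ 1 := pow_le_one₀ (norm_nonneg _) h1
      simp only [Complex.norm_ofNat]
      linarith
    linarith

lemma norm_sigmaFactor_sub_one_le {r : ℝ} {z l : ℂ} (hz : ‖z‖ ≤ r) (hl : r ≤ ‖l‖) :
    ‖sigmaFactor z l - 1‖ ≤ Real.exp 2 * r ^ 3 * ‖l‖ ^ (-3 : ℝ) := by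
  have hr : 0 ≤ r := (norm_nonneg z).trans hz
  rcases eq_or_ne l 0 with rfl | h0
  · simp only [sigmaFactor_zero_right, sub_self, norm_zero]; positivity
  have hl0 : 0 < ‖l‖ := norm_pos_iff.2 h0
  refine (norm_elementaryFactor_sub_one_le ?_).trans ?_
  · rw [norm_div, div_le_one hl0]; exact hz.trans hl
  · rw [norm_div, div_pow, mul_assoc, Real.rpow_neg hl0.le, ← div_eq_mul_inv]
    norm_cast
    gcongr

variable (L : PeriodPair)

lemma summable_lattice_norm_rpow_neg_three : Summable fun l : L.lattice => ‖l.1‖ ^ (-3 : ℝ) :=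
  ZLattice.summable_norm_rpow _ _ (by simp; norm_num)

lemma eventually_cofinite_le_norm (r : ℝ) : ∀ᶠ l : L.lattice in cofinite, r ≤ ‖l.1‖ := by
  refine ((isCompact_iff_finite.mp (isCompact_closedBall (0 : L.lattice) r)).subset ?_)
  intro l hl
  have : ‖l.1‖ < r := by simpa using hl
  simpa using this.le

lemma eventually_norm_sigmaFactor_sub_one_le (r : ℝ) :
    ∀ᶠ l : L.lattice in cofinite, ∀ z ∈ Metric.ball (0 : ℂ) r,
      ‖sigmaFactor z l - 1‖ ≤ Real.exp 2 * r ^ 3 * ‖l.1‖ ^ (-3 : ℝ) := by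
  filter_upwards [eventually_cofinite_le_norm L r] with l hl z hz
  exact norm_sigmaFactor_sub_one_le (by simpa using (mem_ball_zero_iff.1 hz).le) hl

lemma summable_norm_sigmaFactor_sub_one (z : ℂ) :
    Summable fun l : L.lattice => ‖sigmaFactor z l - 1‖ := by
  refine Summable.of_norm_bounded_eventually
    ((summable_lattice_norm_rpow_neg_three L).mul_left (Real.exp 2 * (‖z‖ + 1) ^ 3)) ?_
  filter_upwards [eventually_norm_sigmaFactor_sub_one_le L (‖z‖ + 1)] with l hl
  simpa using hl z (by simp)

lemma multipliable_sigmaFactor_lattice (z : ℂ) :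
    Multipliable fun l : L.lattice => sigmaFactor z l := by
  simpa using multipliable_one_add_of_summable (summable_norm_sigmaFactor_sub_one L z)

lemma injective_inclusion_lattice_diff :
    Function.Injective fun ω : ↥((L.lattice : Set ℂ) \ {0}) => (⟨ω.1, ω.2.1⟩ : L.lattice) :=
  fun _ _ h => Subtype.ext (congrArg (fun x : L.lattice => x.1) h)

lemma sigmaFactor_eq_one_of_notMem_range (z : ℂ) (l : L.lattice)
    (hl : l ∉ range fun ω : ↥((L.lattice : Set ℂ) \ {0}) => (⟨ω.1, ω.2.1⟩ : L.lattice)) :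
    sigmaFactor z l = 1 := by
  have : l.1 = 0 := by
    by_contra h
    exact hl ⟨⟨l.1, l.2, h⟩, rfl⟩
  rw [this, sigmaFactor_zero_right]

lemma multipliable_sigmaFactor (z : ℂ) :
    Multipliable fun ω : ↥((L.lattice : Set ℂ) \ {0}) => sigmaFactor z ω :=
  ((injective_inclusion_lattice_diff L).multipliable_iff (f := fun l : L.lattice => sigmaFactor z l)
    (sigmaFactor_eq_one_of_notMem_range L z)).2 (multipliable_sigmaFactor_lattice L z)

lemma weierstrassSigma_eq (z : ℂ) :
    weierstrassSigma L.lattice z = z * ∏' l : L.lattice, sigmaFactor z l := by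
  have := (injective_inclusion_lattice_diff L).tprod_eq (f := fun l : L.lattice => sigmaFactor z l)
    (fun l hl => by
      by_contra h
      exact hl (sigmaFactor_eq_one_of_notMem_range L z l h))
  rw [weierstrassSigma, ← this]

lemma differentiable_sigmaFactor (l : ℂ) : Differentiable ℂ fun z => sigmaFactor z l := by
  unfold sigmaFactor
  fun_prop

lemma multipliableLocallyUniformlyOn_sigmaFactor (r : ℝ) :
    MultipliableLocallyUniformlyOn (fun (l : L.lattice) z => sigmaFactor z l)
      (Metric.ball (0 : ℂ) r) := by
  simpa using Summable.multipliableLocallyUniformlyOn_one_add Metric.isOpen_ball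
    ((summable_lattice_norm_rpow_neg_three L).mul_left (Real.exp 2 * r ^ 3))
    (eventually_norm_sigmaFactor_sub_one_le L r)
    (fun l => ((differentiable_sigmaFactor l).continuous.sub continuous_const).continuousOn)

lemma differentiable_tprod_sigmaFactor :
    Differentiable ℂ fun z => ∏' l : L.lattice, sigmaFactor z l := by
  intro z
  have h := (multipliableLocallyUniformlyOn_sigmaFactor L (‖z‖ + 1)).hasProdLocallyUniformlyOn
  have := h.differentiableOn (.of_forall fun s => by
    have := fun l : ℂ => differentiable_sigmaFactor l
    fun_prop) Metric.isOpen_ball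
  exact this.differentiableAt (Metric.isOpen_ball.mem_nhds (by simp))

lemma differentiable_weierstrassSigma : Differentiable ℂ (weierstrassSigma L.lattice) := by
  have : weierstrassSigma L.lattice = fun z => z * ∏' l : L.lattice, sigmaFactor z l :=
    funext (weierstrassSigma_eq L)
  rw [this]
  exact differentiable_id.mul (differentiable_tprod_sigmaFactor L)

lemma sigmaFactor_eq_zero_iff {z l : ℂ} : sigmaFactor z l = 0 ↔ l ≠ 0 ∧ z = l := by
  rcases eq_or_ne l 0 with rfl | h
  · simp [sigmaFactor]
  · simp only [sigmaFactor, mul_eq_zero, exp_ne_zero, or_false, sub_eq_zero, ne_eq, h,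
      not_false_eq_true, true_and]
    rw [eq_comm, div_eq_one_iff_eq h]

lemma tprod_sigmaFactor_ne_zero {z : ℂ} (hz : ∀ l ∈ L.lattice, l ≠ 0 → z ≠ l) :
    ∏' l : L.lattice, sigmaFactor z l ≠ 0 := by
  have := tprod_one_add_ne_zero_of_summable (f := fun l : L.lattice => sigmaFactor z l - 1)
    (fun l => by
      have := sigmaFactor_eq_zero_iff (z := z) (l := l)
      have := hz l l.2
      simp only [add_sub_cancel]
      tauto) (summable_norm_sigmaFactor_sub_one L z)
  simpa using this

lemma weierstrassSigma_eq_zero_iff {z : ℂ} : weierstrassSigma L.lattice z = 0 ↔ z ∈ L.lattice := by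
  rw [weierstrassSigma_eq]
  constructor
  · intro h
    by_contra hz
    refine mul_ne_zero ?_ (tprod_sigmaFactor_ne_zero L (z := z) fun l hl _ e => hz (e ▸ hl)) h
    rintro rfl
    exact hz L.lattice.zero_mem
  · intro h
    rcases eq_or_ne z 0 with rfl | h0
    · simp
    · rw [tprod_of_exists_eq_zero (f := fun l : L.lattice => sigmaFactor z l)
        ⟨(⟨z, h⟩ : L.lattice), sigmaFactor_eq_zero_iff.2 ⟨h0, rfl⟩⟩, mul_zero]

lemma hasDerivAt_weierstrassSigma_zero : HasDerivAt (weierstrassSigma L.lattice) 1 0 := by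
  have : weierstrassSigma L.lattice = fun z => z * ∏' l : L.lattice, sigmaFactor z l :=
    funext (weierstrassSigma_eq L)
  rw [this]
  refine ((hasDerivAt_id (0 : ℂ)).mul
    ((differentiable_tprod_sigmaFactor L) 0).hasDerivAt).congr_deriv ?_
  simp [sigmaFactor]

lemma weierstrassSigma_neg (z : ℂ) :
    weierstrassSigma L.lattice (-z) = -weierstrassSigma L.lattice z := by
  rw [weierstrassSigma_eq, weierstrassSigma_eq, ← (Equiv.neg L.lattice).tprod_eq]
  simp [sigmaFactor, neg_div_neg_eq]

lemma logDeriv_sigmaFactor {z l : ℂ} (hl : l ≠ 0) (hz : z ≠ l) :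
    logDeriv (fun z => sigmaFactor z l) z = 1 / (z - l) + 1 / l + z / l ^ 2 := by
  have h := (hasDerivAt_elementaryFactor (z / l)).comp z ((hasDerivAt_id z).div_const l)
  have h' : HasDerivAt (fun z => sigmaFactor z l)
    (-(z / l) ^ 2 * exp (z / l + (z / l) ^ 2 / 2) * (1 / l)) z := h
  rw [logDeriv_apply, h'.deriv, sigmaFactor]
  have : z - l ≠ 0 := sub_ne_zero.2 hz
  have h2 : l - z ≠ 0 := sub_ne_zero.2 hz.symm
  rw [one_sub_div hl]
  field_simp
  ring

lemma norm_zetaTerm_le {r : ℝ} {z l : ℂ} (hz : ‖z‖ < r) (hl : 2 * r ≤ ‖l‖) :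
    ‖1 / (z - l) + 1 / l + z / l ^ 2‖ ≤ 2 * r ^ 2 * ‖l‖ ^ (-3 : ℝ) := by
  have hr : 0 < r := (norm_nonneg z).trans_lt hz
  have hl0 : 0 < ‖l‖ := by linarith
  have h0 : l ≠ 0 := norm_pos_iff.1 hl0
  have h1 : ‖l‖ / 2 ≤ ‖z - l‖ := by
    have := norm_sub_norm_le l z
    rw [norm_sub_rev] at this
    linarith
  have h2 : z - l ≠ 0 := norm_pos_iff.1 (by linarith)
  have : 1 / (z - l) + 1 / l + z / l ^ 2 = z ^ 2 / (l ^ 2 * (z - l)) := by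
    field_simp
    ring
  rw [this, norm_div, norm_mul, norm_pow, norm_pow]
  calc ‖z‖ ^ 2 / (‖l‖ ^ 2 * ‖z - l‖) ≤ r ^ 2 / (‖l‖ ^ 2 * (‖l‖ / 2)) := by gcongr
    _ = 2 * r ^ 2 / ‖l‖ ^ 3 := by field_simp
    _ = _ := by rw [Real.rpow_neg hl0.le, ← div_eq_mul_inv]; norm_cast

lemma hasSumLocallyUniformly_zeta :
    HasSumLocallyUniformly (fun (l : L.lattice) (z : ℂ) => 1 / (z - l) + 1 / (l : ℂ) + z / l ^ 2)
      fun z => ∑' l : L.lattice, (1 / (z - l) + 1 / (l : ℂ) + z / l ^ 2) := by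
  refine L.hasSumLocallyUniformly_aux (u := fun r l => 2 * r ^ 2 * ‖l.1‖ ^ (-3 : ℝ)) _
    (fun _ _ => (summable_lattice_norm_rpow_neg_three L).mul_left _) fun r hr =>
    Filter.eventually_atTop.mpr ⟨2 * r, ?_⟩
  rintro _ h s hs l rfl
  exact norm_zetaTerm_le hs h

lemma isOpen_compl_lattice : IsOpen ((L.lattice : Set ℂ)ᶜ) := L.isClosed_lattice.isOpen_compl

lemma weierstrassZeta_eq_logDeriv (z : ℂ) :
    weierstrassZeta L.lattice z = logDeriv (weierstrassSigma L.lattice) z := rfl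

/-- The lattice sum for the Weierstrass `ζ`-function; the term `l = 0` is `1 / z`. -/
theorem weierstrassZeta_eq_tsum {z : ℂ} (hz : z ∉ L.lattice) :
    weierstrassZeta L.lattice z = ∑' l : L.lattice, (1 / (z - l) + 1 / (l : ℂ) + z / l ^ 2) := by
  have hz0 : z ≠ 0 := by rintro rfl; exact hz L.lattice.zero_mem
  have hne : ∀ l : L.lattice, z ≠ l := fun l h => hz (h ▸ l.2)
  have hs := (hasSumLocallyUniformly_zeta L).hasSum (x := z)
  have hterm : ∀ l : L.lattice, l ≠ 0 → logDeriv (fun z => sigmaFactor z l) z =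
      1 / (z - l) + 1 / (l : ℂ) + z / l ^ 2 := fun l hl =>
    logDeriv_sigmaFactor (by simpa using hl) (hne l)
  -- At `l = 0` the product contributes `0`, whereas the series term is `1 / z` by the convention `1
  -- / 0 = 0`. The discrepancy is restored by the leading factor `z` of `σ`.
  have hterm0 : logDeriv (fun z => sigmaFactor z ((0 : L.lattice) : ℂ)) z = 0 := by
    simp [logDeriv_apply, sigmaFactor_zero_right]
  have hs' : HasSum (fun l : L.lattice => logDeriv (fun z => sigmaFactor z l) z)
      (∑' l : L.lattice, (1 / (z - l) + 1 / (l : ℂ) + z / l ^ 2) - 1 / z) := by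
    classical
    have := hs.update 0 0
    convert! this using 1
    · ext l
      rcases eq_or_ne l 0 with rfl | h
      · rw [Function.update_self, hterm0]
      · rw [Function.update_of_ne h, hterm l h]
    · simp
      ring
  have hprod : ∏' l : L.lattice, sigmaFactor z l ≠ 0 :=
    tprod_sigmaFactor_ne_zero L fun l hl _ h => hz (h ▸ hl)
  have hlog := logDeriv_tprod_eq_tsum (Metric.isOpen_ball (x := (0 : ℂ)) (ε := ‖z‖ + 1))
    (x := z) (by simp) (f := fun (l : L.lattice) z => sigmaFactor z l)
    (fun l h => hne l (sigmaFactor_eq_zero_iff.1 h).2)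
    (fun l => (differentiable_sigmaFactor l).differentiableOn) hs'.summable
    (multipliableLocallyUniformlyOn_sigmaFactor L _) hprod
  rw [weierstrassZeta_eq_logDeriv, show weierstrassSigma L.lattice =
    fun z => z * ∏' l : L.lattice, sigmaFactor z l from funext (weierstrassSigma_eq L),
    logDeriv_mul (f := fun z => z) z hz0 hprod differentiableAt_id
      ((differentiable_tprod_sigmaFactor L) z), hlog,
    hs'.tsum_eq]
  simp [logDeriv_apply]

/-- Locally uniform convergence allows termwise differentiation, and the differentiated terms are
the negatives of those of `℘`. -/
theorem hasDerivAt_weierstrassZeta {z : ℂ} (hz : z ∉ L.lattice) :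
    HasDerivAt (weierstrassZeta L.lattice) (-L.weierstrassP z) z := by
  have hopen := isOpen_compl_lattice L
  have hev : weierstrassZeta L.lattice =ᶠ[𝓝 z]
      fun z => ∑' l : L.lattice, (1 / (z - l) + 1 / (l : ℂ) + z / l ^ 2) := by
    filter_upwards [hopen.mem_nhds hz] with w hw using weierstrassZeta_eq_tsum L hw
  have hne : ∀ w ∈ (L.lattice : Set ℂ)ᶜ, ∀ l : L.lattice, w - l ≠ 0 := fun w hw l h =>
    hw (by rw [sub_eq_zero.1 h]; exact l.2)
  have hunif := (hasSumLocallyUniformly_zeta L).hasSumLocallyUniformlyOn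
    (s := (L.lattice : Set ℂ)ᶜ)
  have hunif' := hasSumLocallyUniformlyOn_iff_tendstoLocallyUniformlyOn.1 hunif
  have hterm : ∀ l : L.lattice, ∀ w ∈ (L.lattice : Set ℂ)ᶜ,
      HasDerivAt (fun z : ℂ => 1 / (z - l) + 1 / (l : ℂ) + z / l ^ 2)
        (-(1 / (w - l) ^ 2 - 1 / (l : ℂ) ^ 2)) w := by
    intro l w hw
    have h1 := ((hasDerivAt_id w).sub_const (l : ℂ)).inv (hne w hw l)
    have h2 := (h1.add_const (1 / (l : ℂ))).add ((hasDerivAt_id w).div_const ((l : ℂ) ^ 2))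
    refine (h2.congr_deriv ?_).congr_of_eventuallyEq (.of_forall fun x => ?_)
    · simp only [id]; ring
    · simp [one_div]
  have hdiff : ∀ᶠ s : Finset L.lattice in atTop, DifferentiableOn ℂ
      (fun z => ∑ l ∈ s, (1 / (z - l) + 1 / (l : ℂ) + z / l ^ 2)) (L.lattice : Set ℂ)ᶜ :=
    .of_forall fun s => .fun_sum fun l _ w hw =>
      (hterm l w hw).differentiableAt.differentiableWithinAt
  have hd := (hunif'.deriv hdiff hopen).tendsto_at hz
  have hP := (L.hasSum_weierstrassP z).neg
  have heq : deriv (fun z => ∑' l : L.lattice, (1 / (z - l) + 1 / (l : ℂ) + z / l ^ 2)) z =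
      -L.weierstrassP z := by
    refine tendsto_nhds_unique hd (hP.congr fun s => ?_)
    simp only [Function.comp_apply]
    exact ((HasDerivAt.fun_sum fun l _ => hterm l z hz).deriv).symm
  refine HasDerivAt.congr_of_eventuallyEq ?_ hev
  rw [← heq]
  exact ((hunif'.differentiableOn hdiff hopen).differentiableAt
    (hopen.mem_nhds hz)).hasDerivAt

end Sigma

/-! ### Quasi-periods and the transformation of `σ` under lattice translations -/

section QuasiPeriod

variable (L : PeriodPair)

instance : Countable L.lattice := L.latticeEquivProd.toEquiv.countable_iff.2 inferInstance

lemma countable_lattice : (L.lattice : Set ℂ).Countable := Set.countable_coe_iff.1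
  (inferInstance : Countable L.lattice)

lemma isPreconnected_compl_lattice : IsPreconnected ((L.lattice : Set ℂ)ᶜ) :=
  ((countable_lattice L).isConnected_compl_of_one_lt_rank (by simp)).isPreconnected

lemma dense_compl_lattice : Dense ((L.lattice : Set ℂ)ᶜ) :=
  (countable_lattice L).dense_compl ℂ

lemma add_notMem_lattice {L : PeriodPair} {z ω : ℂ} (hz : z ∉ L.lattice) (hω : ω ∈ L.lattice) :
    z + ω ∉ L.lattice := fun h => hz (by simpa using L.lattice.sub_mem h hω)

/-- The difference has derivative `-℘(z + ω) + ℘(z) = 0` on the complement of the lattice, which is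
connected because the lattice is countable. -/
lemma exists_quasiPeriod {ω : ℂ} (hω : ω ∈ L.lattice) :
    ∃ c : ℂ, ∀ z : ℂ, z ∉ L.lattice →
      weierstrassZeta L.lattice (z + ω) = weierstrassZeta L.lattice z + c := by
  have hd : ∀ z ∈ (L.lattice : Set ℂ)ᶜ, HasDerivAt
      (fun z => weierstrassZeta L.lattice (z + ω) - weierstrassZeta L.lattice z) 0 z := by
    intro z hz
    have h1 := (hasDerivAt_weierstrassZeta L (add_notMem_lattice hz hω)).comp_add_const z ω
    have h2 := hasDerivAt_weierstrassZeta L hz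
    refine (h1.sub h2).congr_deriv ?_
    have := L.weierstrassP_add_coe z ⟨ω, hω⟩
    simp only at this
    rw [this, sub_self]
  obtain ⟨c, hc⟩ := (isOpen_compl_lattice L).exists_is_const_of_deriv_eq_zero
    (isPreconnected_compl_lattice L)
    (fun z hz => (hd z hz).differentiableAt.differentiableWithinAt) (fun z hz => (hd z hz).deriv)
  exact ⟨c, fun z hz => by rw [← hc z hz]; ring⟩

theorem weierstrassZeta_add {z ω : ℂ} (hω : ω ∈ L.lattice) (hz : z ∉ L.lattice) :
    weierstrassZeta L.lattice (z + ω) = weierstrassZeta L.lattice z + quasiPeriod L.lattice ω :=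
  Classical.epsilon_spec (exists_quasiPeriod L hω) z hz

lemma quasiPeriod_eq_of_forall {ω c : ℂ} (hω : ω ∈ L.lattice)
    (h : ∀ z ∉ L.lattice, weierstrassZeta L.lattice (z + ω) = weierstrassZeta L.lattice z + c) :
    quasiPeriod L.lattice ω = c := by
  have h1 := h _ L.ω₂_div_two_notMem_lattice
  rw [weierstrassZeta_add L hω L.ω₂_div_two_notMem_lattice] at h1
  exact add_left_cancel h1

lemma quasiPeriod_add {ω ω' : ℂ} (hω : ω ∈ L.lattice) (hω' : ω' ∈ L.lattice) :
    quasiPeriod L.lattice (ω + ω') = quasiPeriod L.lattice ω + quasiPeriod L.lattice ω' := by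
  refine quasiPeriod_eq_of_forall L (add_mem hω hω') fun z hz => ?_
  rw [← add_assoc, weierstrassZeta_add L hω' (add_notMem_lattice hz hω),
    weierstrassZeta_add L hω hz, add_assoc]

/-- `ω ↦ η(ω, L)` as a homomorphism on the lattice. -/
def quasiPeriodHom : L.lattice →+ ℂ :=
  AddMonoidHom.mk' (fun ω => quasiPeriod L.lattice ω) fun ω ω' => quasiPeriod_add L ω.2 ω'.2

lemma quasiPeriod_int_combination (m n : ℤ) :
    quasiPeriod L.lattice (m * L.ω₁ + n * L.ω₂) =
      m * quasiPeriod L.lattice L.ω₁ + n * quasiPeriod L.lattice L.ω₂ := by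
  have := map_add (quasiPeriodHom L) (m • ⟨L.ω₁, L.ω₁_mem_lattice⟩) (n • ⟨L.ω₂, L.ω₂_mem_lattice⟩)
  rw [map_zsmul, map_zsmul] at this
  simpa [quasiPeriodHom] using this

lemma weierstrassEta_real_combination (a b : ℝ) :
    weierstrassEta L (a * L.ω₁ + b * L.ω₂) =
      a * quasiPeriod L.lattice L.ω₁ + b * quasiPeriod L.lattice L.ω₂ := by
  have h : (a * L.ω₁ + b * L.ω₂ : ℂ) = a • L.basis 0 + b • L.basis 1 := by simp
  rw [weierstrassEta, h]
  simp only [map_add, map_smul, Module.Basis.repr_self]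
  simp [-PeriodPair.basis_zero, -PeriodPair.basis_one]

lemma exists_real_combination (z : ℂ) : ∃ a b : ℝ, z = a * L.ω₁ + b * L.ω₂ := by
  refine ⟨L.basis.repr z 0, L.basis.repr z 1, ?_⟩
  have := L.basis.sum_repr z
  rw [Fin.sum_univ_two] at this
  simpa using this.symm

theorem weierstrassEta_of_mem {ω : ℂ} (hω : ω ∈ L.lattice) :
    weierstrassEta L ω = quasiPeriod L.lattice ω := by
  obtain ⟨m, n, rfl⟩ := PeriodPair.mem_lattice.1 hω
  rw [quasiPeriod_int_combination]
  exact_mod_cast weierstrassEta_real_combination L m n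

lemma weierstrassEta_add (z w : ℂ) :
    weierstrassEta L (z + w) = weierstrassEta L z + weierstrassEta L w := by
  simp only [weierstrassEta, map_add, Finsupp.add_apply, ofReal_add]
  ring

lemma deriv_weierstrassSigma_neg (z : ℂ) :
    deriv (weierstrassSigma L.lattice) (-z) = deriv (weierstrassSigma L.lattice) z := by
  have h1 : deriv (fun z => weierstrassSigma L.lattice (-z)) z =
      -deriv (weierstrassSigma L.lattice) (-z) := deriv_comp_neg _ _
  have h2 : (fun z => weierstrassSigma L.lattice (-z)) = fun z => -weierstrassSigma L.lattice z :=
    funext (weierstrassSigma_neg L)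
  rw [h2, deriv.fun_neg, neg_inj] at h1
  exact h1.symm

lemma weierstrassZeta_neg (z : ℂ) :
    weierstrassZeta L.lattice (-z) = -weierstrassZeta L.lattice z := by
  rw [weierstrassZeta, weierstrassZeta, deriv_weierstrassSigma_neg, weierstrassSigma_neg, div_neg]

/-- Quasi-periodicity of `σ` up to a constant factor. -/
lemma exists_weierstrassSigma_add {ω : ℂ} (hω : ω ∈ L.lattice) :
    ∃ C : ℂ, C ≠ 0 ∧ ∀ z, weierstrassSigma L.lattice (z + ω) =
      C * exp (quasiPeriod L.lattice ω * z) * weierstrassSigma L.lattice z := by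
  have hσ := differentiable_weierstrassSigma L
  have h1 : Differentiable ℂ fun z => weierstrassSigma L.lattice (z + ω) := by fun_prop
  have hE : Differentiable ℂ fun z => exp (quasiPeriod L.lattice ω * z) := by fun_prop
  have h2 : Differentiable ℂ
      fun z => exp (quasiPeriod L.lattice ω * z) * weierstrassSigma L.lattice z := by fun_prop
  have hne : ∀ z ∈ (L.lattice : Set ℂ)ᶜ, weierstrassSigma L.lattice z ≠ 0 := fun z hz h =>
    hz ((weierstrassSigma_eq_zero_iff L).1 h)
  obtain ⟨C, hC, h⟩ := (logDeriv_eqOn_iff h1.differentiableOn h2.differentiableOn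
    (isOpen_compl_lattice L) (isPreconnected_compl_lattice L)
    (fun z hz => mul_ne_zero (exp_ne_zero _) (hne z hz))
    (fun z hz => hne _ (add_notMem_lattice hz hω))).1 (fun z hz => by
      have e1 : logDeriv (fun z => weierstrassSigma L.lattice (z + ω)) z =
          weierstrassZeta L.lattice (z + ω) := by
        rw [logDeriv_apply, deriv_comp_add_const]; rfl
      have e2 : logDeriv (fun z => exp (quasiPeriod L.lattice ω * z)) z =
          quasiPeriod L.lattice ω := by
        rw [logDeriv_apply]
        have := ((hasDerivAt_id z).const_mul (quasiPeriod L.lattice ω)).cexp.deriv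
        simp only [id, mul_one] at this
        rw [this]
        field_simp [exp_ne_zero]
      rw [e1, logDeriv_mul (f := fun z => exp (quasiPeriod L.lattice ω * z)) z (exp_ne_zero _)
        (hne z hz) (hE z) (hσ z), e2, weierstrassZeta_add L hω hz, add_comm]
      rfl)
  refine ⟨C, hC, fun z => ?_⟩
  by_cases hz : z ∈ L.lattice
  · rw [(weierstrassSigma_eq_zero_iff L).2 hz, (weierstrassSigma_eq_zero_iff L).2 (add_mem hz hω),
      mul_zero]
  · have := h hz
    simpa [mul_assoc] using this

/-- At a lattice point `σ` vanishes, so only one term of the product rule survives. This replaces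
comparing values where both sides are zero. -/
lemma deriv_weierstrassSigma_add {ω C z : ℂ} (hz : z ∈ L.lattice)
    (h : ∀ z, weierstrassSigma L.lattice (z + ω) =
      C * exp (quasiPeriod L.lattice ω * z) * weierstrassSigma L.lattice z) :
    deriv (weierstrassSigma L.lattice) (z + ω) =
      C * exp (quasiPeriod L.lattice ω * z) * deriv (weierstrassSigma L.lattice) z := by
  have hE : DifferentiableAt ℂ (fun z => C * exp (quasiPeriod L.lattice ω * z)) z := by fun_prop
  rw [← deriv_comp_add_const, funext h,
    deriv_fun_mul hE (differentiable_weierstrassSigma L z), (weierstrassSigma_eq_zero_iff L).2 hz,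
    mul_zero, zero_add]

lemma deriv_weierstrassSigma_ne_zero {ω : ℂ} (hω : ω ∈ L.lattice) :
    deriv (weierstrassSigma L.lattice) ω ≠ 0 := by
  obtain ⟨C, hC, h⟩ := exists_weierstrassSigma_add L hω
  have := deriv_weierstrassSigma_add L L.lattice.zero_mem h
  rw [zero_add, (hasDerivAt_weierstrassSigma_zero L).deriv] at this
  rw [this]
  simpa using hC

lemma psi_mul_self (Λ : Submodule ℤ ℂ) (z : ℂ) : psi Λ z * psi Λ z = 1 := by
  unfold psi
  split_ifs <;> norm_num

lemma psi_inv (Λ : Submodule ℤ ℂ) (z : ℂ) : (psi Λ z)⁻¹ = psi Λ z :=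
  inv_eq_of_mul_eq_one_left (psi_mul_self Λ z)

lemma psi_ne_zero (Λ : Submodule ℤ ℂ) (z : ℂ) : psi Λ z ≠ 0 :=
  left_ne_zero_of_mul_eq_one (psi_mul_self Λ z)

/-- Quasi-periodicity of the Weierstrass `σ`-function. -/
theorem weierstrassSigma_add {ω : ℂ} (hω : ω ∈ L.lattice) (z : ℂ) :
    weierstrassSigma L.lattice (z + ω) = psi L.lattice ω *
      exp (quasiPeriod L.lattice ω * (z + 1 / 2 * ω)) * weierstrassSigma L.lattice z := by
  obtain ⟨C, hC, h⟩ := exists_weierstrassSigma_add L hω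
  suffices hψ : C = psi L.lattice ω * exp (quasiPeriod L.lattice ω * (ω / 2)) by
    rw [h, hψ, mul_assoc (psi L.lattice ω), ← exp_add]
    ring_nf
  have hsum : -(ω / 2) + ω = ω / 2 := by ring
  have hexp : exp (quasiPeriod L.lattice ω * -(ω / 2)) * exp (quasiPeriod L.lattice ω * (ω / 2)) =
      1 := by
    rw [← exp_add]; ring_nf; simp
  -- The constant `C` is read off at `z = -ω/2`, which translation by `ω` sends to its negative. If
  -- `ω/2` is a lattice point, the even function `σ'` gives sign `+1`; otherwise the odd function
  -- `σ` is nonzero there and gives `-1`.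
  by_cases hmem : ω / 2 ∈ L.lattice
  · have hp : psi L.lattice ω = 1 := by
      rw [psi, if_neg]
      rintro ⟨-, h2⟩
      exact h2 ⟨ω / 2, hmem, by ring⟩
    have := deriv_weierstrassSigma_add L (neg_mem hmem) h
    rw [hsum, deriv_weierstrassSigma_neg] at this
    have h1 : C * exp (quasiPeriod L.lattice ω * -(ω / 2)) = 1 :=
      mul_right_cancel₀ (deriv_weierstrassSigma_ne_zero L hmem) (by rw [one_mul, ← this])
    rw [hp, one_mul]
    linear_combination exp (quasiPeriod L.lattice ω * (ω / 2)) * h1 - C * hexp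
  · have hp : psi L.lattice ω = -1 := by
      rw [psi, if_pos]
      refine ⟨hω, ?_⟩
      rintro ⟨w, hw, rfl⟩
      exact hmem (by simpa using hw)
    have := h (-(ω / 2))
    rw [hsum, weierstrassSigma_neg] at this
    have hne : weierstrassSigma L.lattice (ω / 2) ≠ 0 := fun h0 =>
      hmem ((weierstrassSigma_eq_zero_iff L).1 h0)
    have h1 : C * exp (quasiPeriod L.lattice ω * -(ω / 2)) = -1 :=
      mul_right_cancel₀ hne (by linear_combination this)
    rw [hp]
    linear_combination exp (quasiPeriod L.lattice ω * (ω / 2)) * h1 - C * hexp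

end QuasiPeriod

/-! ### Entire quotients -/

section Quotient

/-- Division of entire functions by an entire function with simple zeros. -/
lemma exists_differentiable_quotient {f g : ℂ → ℂ} (hf : Differentiable ℂ f)
    (hg : Differentiable ℂ g) (h : ∀ z, g z = 0 → f z = 0 ∧ deriv g z ≠ 0) :
    ∃ H : ℂ → ℂ, Differentiable ℂ H ∧ ∀ z, f z = g z * H z := by
  classical
  refine ⟨fun z => if g z = 0 then deriv f z / deriv g z else f z / g z, fun w => ?_, fun z => ?_⟩
  · by_cases hw : g w = 0
    · obtain ⟨hfw, hgw⟩ := h w hw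
      -- Near a simple zero `w` of `g`, the quotient equals that of the difference slopes at `w`,
      -- whose denominator is nonzero.
      have hdf : DifferentiableAt ℂ (dslope f w) w :=
        ((differentiableOn_dslope univ_mem).2 hf.differentiableOn).differentiableAt univ_mem
      have hdg : DifferentiableAt ℂ (dslope g w) w :=
        ((differentiableOn_dslope univ_mem).2 hg.differentiableOn).differentiableAt univ_mem
      have hne : dslope g w w ≠ 0 := by rwa [dslope_same]
      refine (hdf.div hdg hne).congr_of_eventuallyEq ?_
      filter_upwards [hdg.continuousAt.eventually_ne hne] with z hz
      rcases eq_or_ne z w with rfl | hzw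
      · simp [hw]
      · have e1 : f z = (z - w) * dslope f w z := by
          have := sub_smul_dslope f w z
          rw [hfw, sub_zero, smul_eq_mul] at this
          exact this.symm
        have e2 : g z = (z - w) * dslope g w z := by
          have := sub_smul_dslope g w z
          rw [hw, sub_zero, smul_eq_mul] at this
          exact this.symm
        have hgz : g z ≠ 0 := by rw [e2]; exact mul_ne_zero (sub_ne_zero.2 hzw) hz
        rw [if_neg hgz, Pi.div_apply, e1, e2, mul_div_mul_left _ _ (sub_ne_zero.2 hzw)]
    · refine ((hf w).div (hg w) hw).congr_of_eventuallyEq ?_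
      filter_upwards [(hg w).continuousAt.eventually_ne hw] with z hz
      simp [hz]
  · by_cases hz : g z = 0
    · rw [hz, zero_mul]; exact (h z hz).1
    · simp only [hz, if_false]
      field_simp

end Quotient

/-! ### The theta series and rigidity of entire functions with multipliers -/

section Theta

/-- The theta series `∑ r, (-1)ʳ q^(r(r-1)/2) ζʳ`. -/
def theta (τ z : ℂ) : ℂ := jacobiTheta₂ (z + 1 / 2 - τ / 2) τ

lemma theta_add_one (τ z : ℂ) : theta τ (z + 1) = theta τ z := by
  rw [theta, theta, ← jacobiTheta₂_add_left (z + 1 / 2 - τ / 2)]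
  ring_nf

lemma exp_neg_pi_mul_I : exp (-(Real.pi * I)) = -1 := by rw [exp_neg, exp_pi_mul_I]; norm_num

lemma theta_add_self (τ z : ℂ) : theta τ (z + τ) = -exp (-(2 * Real.pi * I * z)) * theta τ z := by
  rw [theta, theta, show z + τ + 1 / 2 - τ / 2 = (z + 1 / 2 - τ / 2) + τ by ring,
    jacobiTheta₂_add_left', show -Real.pi * I * (τ + 2 * (z + 1 / 2 - τ / 2)) =
      -(2 * Real.pi * I * z) + -(Real.pi * I) by ring, exp_add, exp_neg_pi_mul_I]
  ring

/-- The points `τ` and `τ - 1` give equal values by periodicity; the first gives `-θ(0)` by the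
`τ`-translation law and the second `θ(0)` by evenness of `jacobiTheta₂`. -/
lemma theta_zero (τ : ℂ) : theta τ 0 = 0 := by
  have h1 : jacobiTheta₂ (-(0 + 1 / 2 - τ / 2)) τ = theta τ 0 := jacobiTheta₂_neg_left _ _
  have h2 := theta_add_self τ 0
  have h3 := theta_add_one τ (-1 + τ)
  rw [show (-1 + τ + 1 : ℂ) = 0 + τ by ring, h2] at h3
  rw [show theta τ (-1 + τ) = theta τ 0 by rw [← h1, theta]; ring_nf] at h3
  simp only [mul_zero, neg_zero, exp_zero, neg_mul, one_mul] at h3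
  linear_combination -h3 / 2

variable (τ : ℍ)

lemma differentiable_theta : Differentiable ℂ (theta τ) := fun z => by
  have h := differentiableAt_jacobiTheta₂_fst (z + 1 / 2 - τ / 2) τ.im_pos
  exact h.comp z (f := fun z : ℂ => z + 1 / 2 - (τ : ℂ) / 2) (by fun_prop)

/-- Integration over a period isolates the constant Fourier coefficient; this shows that `theta` is
not identically zero. -/
lemma integral_jacobiTheta₂ : ∫ x in (0 : ℝ)..1, jacobiTheta₂ (x : ℂ) τ = 1 := by
  let f : ℤ → C(ℝ, ℂ) := fun n => ⟨fun x : ℝ => jacobiTheta₂_term n x τ, by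
    unfold jacobiTheta₂_term; fun_prop⟩
  have hnorm : ∀ (n : ℤ) (x : ℝ), ‖jacobiTheta₂_term n x τ‖ = ‖jacobiTheta₂_term n 0 τ‖ := by
    intro n x
    simp [norm_jacobiTheta₂_term]
  have hsum : Summable fun n =>
      ‖(f n).restrict (⟨uIcc (0 : ℝ) 1, isCompact_uIcc⟩ : TopologicalSpace.Compacts ℝ)‖ := by
    refine Summable.of_nonneg_of_le (fun _ => norm_nonneg _) (fun n => ?_)
      ((summable_jacobiTheta₂_term_iff 0 τ).2 τ.im_pos).norm
    rw [ContinuousMap.norm_le _ (norm_nonneg _)]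
    intro x
    exact (hnorm n x).le
  have h := intervalIntegral.hasSum_intervalIntegral_of_summable_norm hsum
  have hint : ∀ n : ℤ, n ≠ 0 → ∫ x in (0 : ℝ)..1, f n x = 0 := by
    intro n hn
    have hc : (2 * Real.pi * I * n : ℂ) ≠ 0 := by
      simp [hn, Real.pi_ne_zero]
    have : ∀ x : ℝ, f n x = exp (Real.pi * I * n ^ 2 * τ) * exp ((2 * Real.pi * I * n) * x) := by
      intro x
      simp only [f, ContinuousMap.coe_mk, jacobiTheta₂_term]
      rw [← exp_add]; ring_nf
    simp_rw [this]
    rw [intervalIntegral.integral_const_mul, integral_exp_mul_complex hc]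
    have : exp (2 * Real.pi * I * n * (1 : ℝ)) = 1 :=
      exp_eq_one_iff.2 ⟨n, by push_cast; ring⟩
    rw [this]
    simp
  have h0 : ∫ x in (0 : ℝ)..1, f 0 x = 1 := by
    simp [f, jacobiTheta₂_term]
  have h1 := h.unique (hasSum_single 0 hint)
  rw [h0] at h1
  exact h1

lemma exists_theta_ne_zero : ∃ z, theta τ z ≠ 0 := by
  by_contra! h
  have h1 : ∀ x : ℝ, jacobiTheta₂ (x : ℂ) τ = 0 := fun x => by
    have := h (x - 1 / 2 + τ / 2)
    rw [theta] at this
    convert this using 2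
    ring
  have h2 := integral_jacobiTheta₂ τ
  simp [h1] at h2

lemma mem_lattice_periods {w : ℂ} :
    w ∈ (periods τ).lattice ↔ ∃ m n : ℤ, (m * τ + n : ℂ) = w := by
  rw [PeriodPair.mem_lattice]
  simp [periods]

lemma periods_ω₁ : (periods τ).ω₁ = τ := rfl
lemma periods_ω₂ : (periods τ).ω₂ = 1 := rfl

lemma self_mem_lattice : (τ : ℂ) ∈ (periods τ).lattice := (periods τ).ω₁_mem_lattice
lemma one_mem_lattice : (1 : ℂ) ∈ (periods τ).lattice := (periods τ).ω₂_mem_lattice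

variable {τ}

lemma periodic_of_mem_lattice {α : Type*} {f : ℂ → α} (h1 : Function.Periodic f 1)
    (hτ : Function.Periodic f τ) {w : ℂ} (hw : w ∈ (periods τ).lattice) :
    Function.Periodic f w := by
  obtain ⟨m, n, rfl⟩ := (mem_lattice_periods τ).1 hw
  have := (hτ.int_mul m).add_period (h1.int_mul n)
  simpa using this

lemma theta_eq_zero_of_mem {w : ℂ} (hw : w ∈ (periods τ).lattice) : theta τ w = 0 := by
  have h := periodic_of_mem_lattice (τ := τ) (f := fun z => theta τ z = 0)
    (fun z => by simp only [theta_add_one])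
    (fun z => by simp [theta_add_self, exp_ne_zero]) hw 0
  rw [zero_add] at h
  exact h.mpr (theta_zero τ)

/-- An entire function whose absolute value is periodic for a lattice is constant. -/
lemma eq_const_of_periodic_norm {g : ℂ → ℂ} (hg : Differentiable ℂ g)
    (h1 : ∀ z, ‖g (z + 1)‖ = ‖g z‖) (hτ : ∀ z, ‖g (z + τ)‖ = ‖g z‖) (z : ℂ) : g z = g 0 := by
  refine hg.apply_eq_apply_of_bounded ?_ z 0
  have hc := IsZLattice.isCompact_range_of_periodic (periods τ).lattice (fun z => ‖g z‖)
    hg.continuous.norm fun z w hw => periodic_of_mem_lattice (f := fun z => ‖g z‖) h1 hτ hw z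
  obtain ⟨R, hR⟩ := hc.isBounded.exists_norm_le
  refine isBounded_iff_forall_norm_le.2 ⟨R, ?_⟩
  rintro _ ⟨z, rfl⟩
  simpa using hR _ ⟨z, rfl⟩

/-- An entire function with constant multipliers along a lattice that vanishes at `0` is zero. -/
lemma eq_zero_of_constant_multipliers {f : ℂ → ℂ} (hf : Differentiable ℂ f) {c : ℂ} (hc : c ≠ 0)
    (h1 : ∀ z, f (z + 1) = f z) (hτ : ∀ z, f (z + τ) = c * f z) (h0 : f 0 = 0) (z : ℂ) :
    f z = 0 := by
  -- Chosen so that `|exp(itτ)| = 1 / |c|`, while `|exp(it)| = 1`: after multiplication by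
  -- `exp(itz)` the absolute value is doubly periodic.
  set t : ℝ := Real.log ‖c‖ / τ.im with ht
  have hE : Differentiable ℂ fun z => exp (I * t * z) * f z := by fun_prop
  have key := eq_const_of_periodic_norm (τ := τ) hE (fun z => ?_) (fun z => ?_) z
  · simpa [h0, exp_ne_zero] using key
  · rw [h1, norm_mul, norm_mul, norm_exp, norm_exp]
    congr 2
    simp
  · rw [hτ, norm_mul, norm_mul (exp (I * t * z)), norm_exp, norm_exp, norm_mul, ← mul_assoc]
    congr 1
    rw [← Real.exp_log (norm_pos_iff.2 hc)]
    rw [← Real.exp_add]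
    congr 1
    have : t * τ.im = Real.log ‖c‖ := by rw [ht]; field_simp [τ.im_ne_zero]
    simp
    linarith

end Theta

/-! ### Legendre's relation and the identification of `σ` with `θ` -/

section Legendre

variable (τ : ℍ)

/-- `exp(-½ η(1) z² + π i z) σ(z)`, a `1`-periodic modification of the `σ`-function. -/
def sigmaPeriodic (z : ℂ) : ℂ :=
  exp (-(1 / 2) * quasiPeriod (periods τ).lattice 1 * z ^ 2 + Real.pi * I * z) *
    weierstrassSigma (periods τ).lattice z

lemma differentiable_sigmaPeriodic : Differentiable ℂ (sigmaPeriodic τ) := by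
  have := differentiable_weierstrassSigma (periods τ)
  unfold sigmaPeriodic
  fun_prop

lemma sigmaPeriodic_eq_zero_iff {z : ℂ} : sigmaPeriodic τ z = 0 ↔ z ∈ (periods τ).lattice := by
  rw [sigmaPeriodic, mul_eq_zero, weierstrassSigma_eq_zero_iff]
  simp [exp_ne_zero]

lemma deriv_sigmaPeriodic {z : ℂ} (hz : z ∈ (periods τ).lattice) :
    deriv (sigmaPeriodic τ) z =
      exp (-(1 / 2) * quasiPeriod (periods τ).lattice 1 * z ^ 2 + Real.pi * I * z) *
        deriv (weierstrassSigma (periods τ).lattice) z := by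
  have hE : DifferentiableAt ℂ (fun z =>
    exp (-(1 / 2) * quasiPeriod (periods τ).lattice 1 * z ^ 2 + Real.pi * I * z)) z := by fun_prop
  rw [show sigmaPeriodic τ = fun z =>
    exp (-(1 / 2) * quasiPeriod (periods τ).lattice 1 * z ^ 2 + Real.pi * I * z) *
      weierstrassSigma (periods τ).lattice z from rfl,
    deriv_fun_mul hE (differentiable_weierstrassSigma _ z), (weierstrassSigma_eq_zero_iff _).2 hz,
    mul_zero, zero_add]

lemma psi_one : psi (periods τ).lattice 1 = -1 := by
  rw [psi, if_pos]
  refine ⟨one_mem_lattice τ, ?_⟩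
  rintro ⟨w, hw, h⟩
  refine (periods τ).ω₂_div_two_notMem_lattice ?_
  rw [periods_ω₂, h]
  simpa using hw

lemma psi_self : psi (periods τ).lattice τ = -1 := by
  rw [psi, if_pos]
  refine ⟨self_mem_lattice τ, ?_⟩
  rintro ⟨w, hw, h⟩
  refine (periods τ).ω₁_div_two_notMem_lattice ?_
  rw [periods_ω₁, h]
  simpa using hw

lemma sigmaPeriodic_add_one (z : ℂ) : sigmaPeriodic τ (z + 1) = sigmaPeriodic τ z := by
  rw [sigmaPeriodic, sigmaPeriodic, weierstrassSigma_add _ (one_mem_lattice τ), psi_one,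
    ← exp_neg_pi_mul_I]
  simp only [← mul_assoc, ← exp_add]
  congr 2
  ring

lemma sigmaPeriodic_add_self (z : ℂ) : sigmaPeriodic τ (z + τ) =
    -exp ((quasiPeriod (periods τ).lattice τ - quasiPeriod (periods τ).lattice 1 * τ) *
      (z + τ / 2) + Real.pi * I * τ) * sigmaPeriodic τ z := by
  rw [sigmaPeriodic, sigmaPeriodic, weierstrassSigma_add _ (self_mem_lattice τ), psi_self]
  simp only [neg_mul, one_mul, mul_neg, ← mul_assoc, ← exp_add, neg_inj]
  congr 2
  ring

lemma exists_theta_sigmaPeriodic_ne_zero :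
    ∃ z, theta τ z ≠ 0 ∧ sigmaPeriodic τ z ≠ 0 := by
  obtain ⟨z, hz⟩ := exists_theta_ne_zero τ
  exact ⟨z, hz, fun h => hz (theta_eq_zero_of_mem ((sigmaPeriodic_eq_zero_iff τ).1 h))⟩

/-- The multiplier for translation by `τ` must itself be `1`-periodic in `z`, since translations by
`1` and `τ` commute; hence the exponential of the difference is `1`. -/
lemma exists_int_quasiPeriod :
    ∃ k : ℤ, quasiPeriod (periods τ).lattice τ - quasiPeriod (periods τ).lattice 1 * τ =
      k * (2 * Real.pi * I) := by
  obtain ⟨z, -, hz⟩ := exists_theta_sigmaPeriodic_ne_zero τ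
  refine exp_eq_one_iff.1 ?_
  have h1 := sigmaPeriodic_add_self τ (z + 1)
  rw [add_right_comm, sigmaPeriodic_add_one, sigmaPeriodic_add_one, sigmaPeriodic_add_self] at h1
  have h2 := mul_right_cancel₀ hz h1
  rw [neg_inj] at h2
  have h3 : exp ((quasiPeriod (periods τ).lattice τ - quasiPeriod (periods τ).lattice 1 * τ) *
      (z + 1 + τ / 2) + Real.pi * I * τ) =
      exp (quasiPeriod (periods τ).lattice τ - quasiPeriod (periods τ).lattice 1 * τ) *
      exp ((quasiPeriod (periods τ).lattice τ - quasiPeriod (periods τ).lattice 1 * τ) *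
      (z + τ / 2) + Real.pi * I * τ) := by
    rw [← exp_add]; ring_nf
  rw [h3] at h2
  exact (mul_right_cancel₀ (exp_ne_zero _) (by rw [one_mul]; exact h2)).symm

lemma sigmaPeriodic_add_self_of_int {k : ℤ}
    (hk : quasiPeriod (periods τ).lattice τ - quasiPeriod (periods τ).lattice 1 * τ =
      k * (2 * Real.pi * I)) (z : ℂ) :
    sigmaPeriodic τ (z + τ) =
      -exp ((k + 1) * (Real.pi * I * τ)) * exp (2 * Real.pi * I * z) ^ k * sigmaPeriodic τ z := by
  rw [sigmaPeriodic_add_self, hk, ← exp_int_mul, neg_mul (exp _) (exp _), ← exp_add]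
  ring_nf

lemma theta_pow_add_self (n : ℕ) (z : ℂ) : theta τ (z + τ) ^ n =
    (-1) ^ n * exp (2 * Real.pi * I * z) ^ (-(n : ℤ)) * theta τ z ^ n := by
  rw [theta_add_self, mul_pow, neg_pow, exp_neg, inv_pow, zpow_neg, zpow_natCast]

lemma exists_theta_eq_sigmaPeriodic_mul :
    ∃ H : ℂ → ℂ, Differentiable ℂ H ∧ ∀ z, theta τ z = sigmaPeriodic τ z * H z :=
  exists_differentiable_quotient (differentiable_theta τ) (differentiable_sigmaPeriodic τ)
    fun z hz => by
      have hz' := (sigmaPeriodic_eq_zero_iff τ).1 hz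
      refine ⟨theta_eq_zero_of_mem hz', ?_⟩
      rw [deriv_sigmaPeriodic τ hz']
      exact mul_ne_zero (exp_ne_zero _) (deriv_weierstrassSigma_ne_zero _ hz')

/-- Off the lattice `sigmaPeriodic` can be cancelled; density and continuity give the rest. -/
lemma quotient_add_one {H : ℂ → ℂ} (hH : Differentiable ℂ H)
    (h : ∀ z, theta τ z = sigmaPeriodic τ z * H z) (z : ℂ) : H (z + 1) = H z := by
  have hc : Continuous fun z => H (z + 1) := hH.continuous.comp (by fun_prop)
  refine congrFun (hc.ext_on (dense_compl_lattice (periods τ)) hH.continuous fun z hz => ?_) z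
  have hne : sigmaPeriodic τ z ≠ 0 := fun h0 => hz ((sigmaPeriodic_eq_zero_iff τ).1 h0)
  have h1 := h (z + 1)
  rw [theta_add_one, sigmaPeriodic_add_one, h z] at h1
  exact (mul_left_cancel₀ hne h1).symm

lemma quotient_add_self {H : ℂ → ℂ} (hH : Differentiable ℂ H)
    (h : ∀ z, theta τ z = sigmaPeriodic τ z * H z) {k : ℤ}
    (hk : quasiPeriod (periods τ).lattice τ - quasiPeriod (periods τ).lattice 1 * τ =
      k * (2 * Real.pi * I)) (z : ℂ) :
    H (z + τ) = exp (-((k + 1) * (Real.pi * I * τ))) *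
      exp (2 * Real.pi * I * z) ^ (-(k + 1)) * H z := by
  have hc : Continuous fun z => H (z + τ) := hH.continuous.comp (by fun_prop)
  have hc' : Continuous fun z => exp (-((k + 1) * (Real.pi * I * τ))) *
      exp (2 * Real.pi * I * z) ^ (-(k + 1)) * H z := by
    refine Continuous.mul ?_ hH.continuous
    simp only [← exp_int_mul]
    fun_prop
  refine congrFun (hc.ext_on (dense_compl_lattice (periods τ)) hc' fun z hz => ?_) z
  have hne : sigmaPeriodic τ z ≠ 0 := fun h0 => hz ((sigmaPeriodic_eq_zero_iff τ).1 h0)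
  have h1 := h (z + τ)
  rw [theta_add_self, sigmaPeriodic_add_self_of_int τ hk, h z] at h1
  have hE : exp (2 * Real.pi * I * z) ≠ 0 := exp_ne_zero _
  simp only
  rw [exp_neg, zpow_neg, zpow_add_one₀ hE]
  have hE' := zpow_ne_zero k hE
  have hE2 := exp_ne_zero ((k + 1) * (Real.pi * I * τ))
  rw [exp_neg] at h1
  field_simp at h1 ⊢
  linear_combination h1

/-- Legendre's relation. -/
theorem legendre_relation :
    quasiPeriod (periods τ).lattice τ =
      quasiPeriod (periods τ).lattice 1 * τ - 2 * Real.pi * I := by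
  obtain ⟨k, hk⟩ := exists_int_quasiPeriod τ
  obtain ⟨H, hH, hθ⟩ := exists_theta_eq_sigmaPeriodic_mul τ
  obtain ⟨z₀, hz₀, hz₀'⟩ := exists_theta_sigmaPeriodic_ne_zero τ
  have hdθ := differentiable_theta τ
  have hdσ := differentiable_sigmaPeriodic τ
  have hσ0 : sigmaPeriodic τ 0 = 0 :=
    (sigmaPeriodic_eq_zero_iff τ).2 (periods τ).lattice.zero_mem
  -- A power of `θ` cancels the power of `exp(2πiz)` in a multiplier: for `k < -1` the product is `H
  -- θ^(-k-1)`, which vanishes at `0` through `θ`; for `k > -1` it is `sigmaPeriodic · θ^k`, which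
  -- vanishes at `0` through `sigmaPeriodic`, even when `k = 0`.
  rcases lt_trichotomy k (-1) with hlt | heq | hgt
  · exfalso
    obtain ⟨n, hn⟩ : ∃ n : ℕ, -(k + 1) = n := Int.eq_ofNat_of_zero_le (by omega)
    have hn0 : n ≠ 0 := by omega
    have := eq_zero_of_constant_multipliers (τ := τ) (f := fun z => H z * theta τ z ^ n)
      (by fun_prop) (c := exp (-((k + 1) * (Real.pi * I * τ))) * (-1) ^ n)
      (mul_ne_zero (exp_ne_zero _) (by simp))
      (fun z => by simp only [theta_add_one, quotient_add_one τ hH hθ])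
      (fun z => by
        rw [theta_pow_add_self, quotient_add_self τ hH hθ hk, hn, zpow_neg]
        field_simp [exp_ne_zero])
      (by simp [theta_zero, hn0]) z₀
    rcases mul_eq_zero.1 this with h | h
    · exact hz₀ (by rw [hθ, h, mul_zero])
    · exact hz₀ (pow_eq_zero_iff hn0 |>.1 h)
  · subst heq
    push_cast at hk
    linear_combination hk
  · exfalso
    obtain ⟨n, rfl⟩ : ∃ n : ℕ, k = n := Int.eq_ofNat_of_zero_le (by omega)
    have := eq_zero_of_constant_multipliers (τ := τ) (f := fun z => sigmaPeriodic τ z * theta τ z ^ n)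
      (by fun_prop) (c := -exp (((n : ℤ) + 1) * (Real.pi * I * τ)) * (-1) ^ n)
      (mul_ne_zero (neg_ne_zero.2 (exp_ne_zero _)) (by simp))
      (fun z => by simp only [theta_add_one, sigmaPeriodic_add_one])
      (fun z => by
        rw [theta_pow_add_self, sigmaPeriodic_add_self_of_int τ hk, zpow_neg]
        field_simp [exp_ne_zero])
      (by simp [hσ0]) z₀
    rcases mul_eq_zero.1 this with h | h
    · exact hz₀' h
    · exact hz₀ (eq_zero_of_pow_eq_zero h)

/-- With `k = -1` the quotient `H` is doubly periodic, hence constant. Since `sigmaPeriodic` has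
derivative `1` at `0`, the constant is `θ'(0)`. -/
theorem deriv_theta_mul_sigmaPeriodic (z : ℂ) :
    theta τ z = deriv (theta τ) 0 * sigmaPeriodic τ z := by
  obtain ⟨H, hH, hθ⟩ := exists_theta_eq_sigmaPeriodic_mul τ
  have hk : quasiPeriod (periods τ).lattice τ - quasiPeriod (periods τ).lattice 1 * τ =
      (-1 : ℤ) * (2 * Real.pi * I) := by
    rw [legendre_relation]; push_cast; ring
  have hconst := eq_const_of_periodic_norm (τ := τ) hH
    (fun z => by rw [quotient_add_one τ hH hθ])
    (fun z => by rw [quotient_add_self τ hH hθ hk]; simp)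
  have hθ' : theta τ = fun z => sigmaPeriodic τ z * H 0 :=
    funext fun z => by rw [hθ, hconst]
  have hd : deriv (theta τ) 0 = H 0 := by
    rw [hθ', deriv_mul_const (differentiable_sigmaPeriodic τ 0),
      deriv_sigmaPeriodic τ (periods τ).lattice.zero_mem, (hasDerivAt_weierstrassSigma_zero _).deriv]
    simp
  rw [hd, hθ, hconst, mul_comm]

theorem deriv_theta_ne_zero : deriv (theta τ) 0 ≠ 0 := fun h => by
  obtain ⟨z, hz⟩ := exists_theta_ne_zero τ
  rw [deriv_theta_mul_sigmaPeriodic, h, zero_mul] at hz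
  exact hz rfl

end Legendre

/-! ### Expansions in `q`, including the limit `q = 0` -/

section QSeries

/-- The exponent `r(r-1)/2`. -/
def triangle (r : ℤ) : ℕ := (r * (r - 1) / 2).toNat

lemma two_mul_triangle (r : ℤ) : 2 * (triangle r : ℤ) = r * (r - 1) := by
  have h1 : 0 ≤ r * (r - 1) := by
    rcases le_or_gt r 0 with h | h
    · exact mul_nonneg_of_nonpos_of_nonpos h (by omega)
    · exact mul_nonneg h.le (by omega)
  have h2 : 2 ∣ r * (r - 1) := (Int.even_mul_pred_self r).two_dvd
  rw [triangle, Int.toNat_of_nonneg (by omega)]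
  omega

lemma jacobiTheta₂_term_eq (τ z : ℂ) (r : ℤ) :
    jacobiTheta₂_term r (z + 1 / 2 - τ / 2) τ =
      (-1) ^ r * exp (2 * Real.pi * I * τ) ^ triangle r * exp (2 * Real.pi * I * z) ^ r := by
  have h : (2 * triangle r : ℂ) = r * (r - 1) := by exact_mod_cast two_mul_triangle r
  rw [jacobiTheta₂_term, ← exp_pi_mul_I, ← exp_int_mul, ← exp_int_mul, ← exp_nat_mul, ← exp_add,
    ← exp_add]
  congr 1
  linear_combination -(Real.pi * I * τ) * h

variable (τ : ℍ)

lemma hasSum_theta (z : ℂ) :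
    HasSum (fun r : ℤ => (-1 : ℂ) ^ r * exp (2 * Real.pi * I * τ) ^ triangle r *
      exp (2 * Real.pi * I * z) ^ r) (theta τ z) := by
  rw [theta]
  simpa only [jacobiTheta₂_term_eq] using
    hasSum_jacobiTheta₂_term (z + 1 / 2 - (τ : ℂ) / 2) τ.im_pos

lemma hasSum_deriv_theta :
    HasSum (fun r : ℤ => 2 * Real.pi * I * r * (-1 : ℂ) ^ r * exp (2 * Real.pi * I * τ) ^ triangle r)
      (deriv (theta τ) 0) := by
  have h1 : HasDerivAt (theta τ) (jacobiTheta₂' (0 + 1 / 2 - (τ : ℂ) / 2) τ) 0 := by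
    have h := hasDerivAt_jacobiTheta₂_fst (0 + 1 / 2 - (τ : ℂ) / 2) τ.im_pos
    have h2 : HasDerivAt (fun z : ℂ => z + 1 / 2 - (τ : ℂ) / 2) 1 0 :=
      ((hasDerivAt_id _).add_const _).sub_const _
    have := HasDerivAt.comp (0 : ℂ) h h2
    rw [mul_one] at this
    exact this
  rw [h1.deriv]
  have h2 := hasSum_jacobiTheta₂'_term (0 + 1 / 2 - (τ : ℂ) / 2) τ.im_pos
  refine h2.congr_fun fun r => ?_
  rw [jacobiTheta₂'_term, jacobiTheta₂_term_eq]
  simp only [mul_zero, exp_zero, one_zpow, mul_one]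
  ring

/-- The derivative of `theta` at `z = 0`, as a function of `q`. -/
def thetaDerivQ (q : ℂ) : ℂ := ∑' r : ℤ, 2 * Real.pi * I * r * (-1 : ℂ) ^ r * q ^ triangle r

lemma thetaDerivQ_exp : thetaDerivQ (exp (2 * Real.pi * I * τ)) = deriv (theta τ) 0 :=
  (hasSum_deriv_theta τ).tsum_eq

lemma exists_exp_eq {q : ℂ} (hq : q ≠ 0) (h1 : ‖q‖ < 1) : ∃ τ : ℍ, exp (2 * Real.pi * I * τ) = q := by
  have hpi : (0 : ℝ) < 2 * Real.pi := by positivity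
  have him : (log q / (2 * Real.pi * I)).im = -Real.log ‖q‖ / (2 * Real.pi) := by
    have : log q / (2 * Real.pi * I) = (-I * log q) / ((2 * Real.pi : ℝ) : ℂ) := by
      have : (Real.pi : ℂ) ≠ 0 := by exact_mod_cast Real.pi_ne_zero
      push_cast
      field_simp
      rw [I_sq]; ring
    rw [this, div_ofReal_im]
    simp [log_re]
  refine ⟨⟨log q / (2 * Real.pi * I), ?_⟩, ?_⟩
  · rw [him]
    exact div_pos (neg_pos.2 (Real.log_neg (norm_pos_iff.2 hq) h1)) hpi
  · rw [UpperHalfPlane.coe_mk, mul_div_cancel₀ _ two_pi_I_ne_zero, exp_log hq]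

lemma differentiableOn_thetaDerivQ : DifferentiableOn ℂ thetaDerivQ (Metric.ball 0 1) := by
  intro q hq
  -- The absolutely convergent series at a real point `s` between `‖q‖` and `1` majorizes the series
  -- on the disc of radius `s`.
  obtain ⟨s, hs, hs1⟩ := exists_between (mem_ball_zero_iff.1 hq)
  have hs0 : 0 < s := (norm_nonneg q).trans_lt hs
  obtain ⟨τ, hτ⟩ := exists_exp_eq (q := (s : ℂ)) (by exact_mod_cast hs0.ne')
    (by rw [norm_real, Real.norm_of_nonneg hs0.le]; exact hs1)
  have hsum := (hasSum_deriv_theta τ).summable.norm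
  rw [hτ] at hsum
  have hd : DifferentiableOn ℂ thetaDerivQ (Metric.ball 0 s) := by
    refine differentiableOn_tsum_of_summable_norm hsum (fun r => by fun_prop) Metric.isOpen_ball ?_
    intro r w hw
    rw [norm_mul, norm_mul _ ((s : ℂ) ^ triangle r), norm_pow, norm_pow, norm_real,
      Real.norm_of_nonneg hs0.le]
    gcongr
    exact (mem_ball_zero_iff.1 hw).le
  exact (hd.differentiableAt (Metric.isOpen_ball.mem_nhds
    (mem_ball_zero_iff.2 hs))).differentiableWithinAt

/-- Only `r = 0` and `r = 1` have exponent `0`, and the factor `r` removes the first. -/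
lemma thetaDerivQ_zero : thetaDerivQ 0 = -(2 * Real.pi * I) := by
  rw [thetaDerivQ, tsum_eq_single 1]
  · simp [triangle]
  · intro r hr
    rcases eq_or_ne r 0 with rfl | h0
    · simp
    · have : triangle r ≠ 0 := fun h => by
        have := two_mul_triangle r
        rw [h] at this
        rcases mul_eq_zero.1 this.symm with h | h <;> omega
      simp [this]

lemma thetaDerivQ_ne_zero {q : ℂ} (hq : q ∈ Metric.ball (0 : ℂ) 1) : thetaDerivQ q ≠ 0 := by
  rcases eq_or_ne q 0 with rfl | h0
  · rw [thetaDerivQ_zero]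
    exact neg_ne_zero.2 two_pi_I_ne_zero
  · obtain ⟨τ, rfl⟩ := exists_exp_eq h0 (mem_ball_zero_iff.1 hq)
    rw [thetaDerivQ_exp]
    exact deriv_theta_ne_zero τ

lemma norm_exp_two_pi_I_lt_one : ‖exp (2 * Real.pi * I * τ)‖ < 1 := by
  rw [norm_exp, Real.exp_lt_one_iff]
  simp [Real.pi_pos, τ.im_pos]

/-- `thetaDerivQ` has no zero in the open unit disc, the point `q = 0` included, so the Taylor
series of its inverse converges there without negative powers. -/
lemma exists_hasSum_inv_deriv_theta : ∃ p : ℕ → ℂ, ∀ τ : ℍ,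
    HasSum (fun n => p n * exp (2 * Real.pi * I * τ) ^ n) (deriv (theta τ) 0)⁻¹ := by
  have hd : DifferentiableOn ℂ (fun q => (thetaDerivQ q)⁻¹) (Metric.ball 0 ((1 : NNReal) : ℝ)) := by
    rw [NNReal.coe_one]
    exact differentiableOn_thetaDerivQ.inv fun q hq => thetaDerivQ_ne_zero hq
  refine ⟨fun n => (n.factorial : ℂ)⁻¹ * iteratedDeriv n (fun q => (thetaDerivQ q)⁻¹) 0,
    fun τ => ?_⟩
  have h := hasSum_taylorSeries_on_ball hd (z := exp (2 * Real.pi * I * τ))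
    (by simpa using norm_exp_two_pi_I_lt_one τ)
  rw [thetaDerivQ_exp] at h
  refine h.congr_fun fun n => ?_
  simp only [smul_eq_mul, sub_zero]
  ring

lemma abs_le_of_triangle_le {n : ℕ} {r : ℤ} (h : triangle r ≤ n) :
    |r| ≤ (Nat.sqrt (2 * n) + 1 : ℕ) := by
  have h1 := two_mul_triangle r
  by_contra! hlt
  push_cast at hlt
  have h2 : 2 * n < (Nat.sqrt (2 * n) + 1) * (Nat.sqrt (2 * n) + 1) := Nat.lt_succ_sqrt _
  have h3 : (2 * n : ℤ) < ((Nat.sqrt (2 * n) : ℤ) + 1) * ((Nat.sqrt (2 * n) : ℤ) + 1) := by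
    exact_mod_cast h2
  have h4 : (triangle r : ℤ) ≤ n := by exact_mod_cast h
  have h5 : (0 : ℤ) ≤ Nat.sqrt (2 * n) := by positivity
  rcases abs_cases r with ⟨h6, h7⟩ | ⟨h6, h7⟩ <;> nlinarith

lemma tendsto_sqrt_two_mul_add_one_div :
    Tendsto (fun n : ℕ => ((Nat.sqrt (2 * n) + 1 : ℕ) : ℝ) / (n : ℝ)) atTop (𝓝 0) := by
  have hlim : Tendsto (fun n : ℕ => √2 * (√(n : ℝ))⁻¹ + ((n : ℝ))⁻¹) atTop (𝓝 0) := by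
    have h1 : Tendsto (fun n : ℕ => (√(n : ℝ))⁻¹) atTop (𝓝 0) :=
      (Real.tendsto_sqrt_atTop.comp tendsto_natCast_atTop_atTop).inv_tendsto_atTop
    have h2 : Tendsto (fun n : ℕ => ((n : ℝ))⁻¹) atTop (𝓝 0) :=
      tendsto_natCast_atTop_atTop.inv_tendsto_atTop
    simpa using (h1.const_mul √2).add h2
  refine squeeze_zero (fun n => by positivity) (fun n => ?_) hlim
  rcases Nat.eq_zero_or_pos n with rfl | hn
  · simp
  have hn' : (0 : ℝ) < n := by exact_mod_cast hn
  have h1 : ((Nat.sqrt (2 * n) : ℕ) : ℝ) ≤ √2 * √n := by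
    rw [← Real.sqrt_mul (by norm_num)]
    have := Real.nat_sqrt_le_real_sqrt (a := 2 * n)
    push_cast at this
    exact this
  have h2 : (√(n : ℝ))⁻¹ = √n / n := by
    rw [Real.sqrt_div_self', one_div]
  push_cast
  rw [h2, add_div, ← mul_div_assoc, ← one_div (n : ℝ)]
  gcongr

end QSeries

/-! ### The Fourier development of `ρ⁻¹σ` -/

section Fourier

variable (τ : ℍ)

lemma sigmaPeriodic_eq_theta_div (z : ℂ) :
    sigmaPeriodic τ z = (deriv (theta τ) 0)⁻¹ * theta τ z := by
  rw [deriv_theta_mul_sigmaPeriodic τ z, inv_mul_cancel_left₀ (deriv_theta_ne_zero τ)]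

lemma weierstrassEta_one :
    weierstrassEta (periods τ) 1 = quasiPeriod (periods τ).lattice 1 :=
  weierstrassEta_of_mem _ (one_mem_lattice τ)

lemma sigma_eq_mul_sigmaPeriodic (z : ℂ) : sigma τ z =
    exp (1 / 2 * quasiPeriod (periods τ).lattice 1 * z ^ 2 - Real.pi * I * z) *
      sigmaPeriodic τ z := by
  rw [sigmaPeriodic, ← mul_assoc, ← exp_add, sigma]
  ring_nf
  simp

lemma rho_zpow_neg_one_mul_sigma (z : ℂ) : rho τ z ^ (-1 : ℤ) * sigma τ z = sigmaPeriodic τ z := by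
  rw [sigma_eq_mul_sigmaPeriodic, rho, weierstrassEta_one, zpow_neg_one,
    inv_mul_cancel_left₀ (exp_ne_zero _)]

theorem hasFourierDevelopment_sigmaPeriodic : HasFourierDevelopment sigmaPeriodic := by
  obtain ⟨p, hp⟩ := exists_hasSum_inv_deriv_theta
  refine ⟨fun n => Nat.sqrt (2 * n) + 1,
    fun n r => if triangle r ≤ n then p (n - triangle r) * (-1) ^ r else 0, ?_,
    tendsto_sqrt_two_mul_add_one_div, ?_, ?_⟩
  · intro m n h
    simp only
    gcongr
  · intro n r h
    exact if_neg fun h' => (abs_le_of_triangle_le h').not_gt h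
  · intro τ z
    have h1 := hp τ
    have h2 := hasSum_theta τ z
    have hs := summable_mul_of_summable_norm h1.summable.norm h2.summable.norm
    have h3 := HasSum.mul h1 h2 hs
    rw [← sigmaPeriodic_eq_theta_div] at h3
    -- The product of the two series is indexed by `(m, r)` with total `q`-exponent `m + r(r-1)/2`;
    -- pairs outside the image of this map carry coefficient `0`.
    have hinj : Function.Injective fun x : ℕ × ℤ => (x.1 + triangle x.2, x.2) := by
      rintro ⟨a, b⟩ ⟨c, d⟩ h
      simp only [Prod.mk.injEq] at h
      obtain ⟨h, rfl⟩ := h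
      rw [Nat.add_right_cancel h]
    refine (hinj.hasSum_iff ?_).1 (h3.congr_fun fun x => ?_)
    · rintro ⟨n, r⟩ hx
      simp only
      rw [if_neg, zero_mul, zero_mul]
      intro hle
      exact hx ⟨(n - triangle r, r), by simp [Nat.sub_add_cancel hle]⟩
    · simp only [Function.comp_apply, le_add_iff_nonneg_left, zero_le, if_true,
        Nat.add_sub_cancel, pow_add]
      ring

end Fourier

/-! ### Joint holomorphy in `(τ, z)` -/

section Holomorphy

lemma lattice_tsum_eq (τ : ℍ) (f : ℂ → ℂ) :
    ∑' l : (periods τ).lattice, f l = ∑' x : Fin 2 → ℤ, f (x 0 * τ + x 1) := by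
  rw [← ((finTwoArrowEquiv ℤ).trans (periods τ).latticeEquivProd.symm.toEquiv).tsum_eq]
  refine tsum_congr fun x => ?_
  change f ((periods τ).latticeEquivProd.symm (x 0, x 1)).1 = _
  rw [PeriodPair.latticeEquiv_symm_apply, periods_ω₁, periods_ω₂, mul_one]

/-- The quasi-period relation at `z = -1/2`, with oddness, gives `η(1)` as twice the Weierstrass
ζ-value at `1/2`. -/
lemma quasiPeriod_one_eq_tsum (τ : ℍ) : quasiPeriod (periods τ).lattice 1 =
    2 * ∑' x : Fin 2 → ℤ, (1 / (1 / 2 - (x 0 * τ + x 1 : ℂ)) + 1 / (x 0 * τ + x 1 : ℂ) +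
      1 / 2 / (x 0 * τ + x 1 : ℂ) ^ 2) := by
  have hhalf : (1 / 2 : ℂ) ∉ (periods τ).lattice := (periods τ).ω₂_div_two_notMem_lattice
  have hneg : -(1 / 2 : ℂ) ∉ (periods τ).lattice := fun h => hhalf (by simpa using neg_mem h)
  have h := weierstrassZeta_add (periods τ) (one_mem_lattice τ) hneg
  rw [weierstrassZeta_neg, show -(1 / 2 : ℂ) + 1 = 1 / 2 by norm_num] at h
  rw [← lattice_tsum_eq τ fun l => 1 / (1 / 2 - l) + 1 / l + 1 / 2 / l ^ 2,
    ← weierstrassZeta_eq_tsum _ hhalf]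
  linear_combination -h

/-- With `l = x₀τ + x₁` the three terms combine to `1 / (2l²(1 - 2l))`. Both `l` and `1 - 2l` are
nonzero integral forms in `τ, 1`, the latter because its constant coefficient is odd, so the uniform
Eisenstein lower bound applies to each. -/
lemma norm_zetaTerm_half_le {A B : ℝ} (hB : 0 < B) {τ : ℍ}
    (hτ : τ ∈ UpperHalfPlane.verticalStrip A B) {x : Fin 2 → ℤ} (hx : x ≠ 0) :
    ‖1 / (1 / 2 - (x 0 * τ + x 1 : ℂ)) + 1 / (x 0 * τ + x 1 : ℂ) +
      1 / 2 / (x 0 * τ + x 1 : ℂ) ^ 2‖ ≤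
    (EisensteinSeries.r ⟨⟨A, B⟩, hB⟩)⁻¹ ^ 3 * ‖x‖ ^ (-3 : ℝ) := by
  set s := EisensteinSeries.r ⟨⟨A, B⟩, hB⟩ with hs
  have hs0 : 0 < s := EisensteinSeries.r_pos _
  have hsr : s ≤ EisensteinSeries.r τ := EisensteinSeries.r_lower_bound_on_verticalStrip τ hB hτ
  have hx0 : 0 < ‖x‖ := norm_pos_iff.2 hx
  have h1 : s * ‖x‖ ≤ ‖(x 0 * τ + x 1 : ℂ)‖ :=
    (mul_le_mul_of_nonneg_right hsr hx0.le).trans (EisensteinSeries.r_mul_max_le τ hx)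
  have h2 : s * ‖x‖ ≤ ‖1 - 2 * (x 0 * τ + x 1 : ℂ)‖ := by
    set y : Fin 2 → ℤ := ![-2 * x 0, 1 - 2 * x 1] with hy
    have hy0 : y ≠ 0 := fun h => by
      have := congrFun h 1
      simp [hy] at this
      omega
    have hxy : ‖x‖ ≤ ‖y‖ := by
      rw [EisensteinSeries.norm_eq_max_natAbs, EisensteinSeries.norm_eq_max_natAbs]
      simp only [hy, Matrix.cons_val_zero, Matrix.cons_val_one]
      norm_cast
      omega
    have h3 := EisensteinSeries.r_mul_max_le τ hy0
    have h4 : (y 0 * τ + y 1 : ℂ) = 1 - 2 * (x 0 * τ + x 1 : ℂ) := by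
      simp [hy]; ring
    rw [h4] at h3
    exact (mul_le_mul hsr hxy hx0.le (hs0.le.trans hsr)).trans h3
  have hsx : 0 < s * ‖x‖ := mul_pos hs0 hx0
  set l : ℂ := x 0 * τ + x 1 with hl
  have hl0 : l ≠ 0 := norm_pos_iff.1 (hsx.trans_le h1)
  have hl1 : 1 - 2 * l ≠ 0 := norm_pos_iff.1 (hsx.trans_le h2)
  have hl2 : 1 / 2 - l ≠ 0 := fun h => hl1 (by linear_combination 2 * h)
  have heq : 1 / (1 / 2 - l) + 1 / l + 1 / 2 / l ^ 2 = 1 / (2 * (l ^ 2 * (1 - 2 * l))) := by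
    rw [show 1 / 2 - l = (1 - 2 * l) / 2 by ring]
    field_simp
    ring
  rw [heq, norm_div, norm_one, norm_mul, norm_mul, norm_pow, Complex.norm_ofNat]
  calc 1 / (2 * (‖l‖ ^ 2 * ‖1 - 2 * l‖)) ≤ 1 / (1 * ((s * ‖x‖) ^ 2 * (s * ‖x‖))) := by
        gcongr; norm_num
    _ = s⁻¹ ^ 3 * ‖x‖ ^ (-3 : ℝ) := by
        rw [Real.rpow_neg hx0.le]
        norm_cast
        field_simp

lemma differentiableOn_quasiPeriod_one :
    DifferentiableOn ℂ (fun t : ℂ => quasiPeriod (periods (UpperHalfPlane.ofComplex t)).lattice 1)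
      {t | 0 < t.im} := by
  intro t ht
  set A := |t.re| + 1
  set B := t.im / 2
  have hB : 0 < B := half_pos ht
  set U : Set ℂ := {w | |w.re| < A ∧ B < w.im} with hU
  have hUo : IsOpen U := by
    refine IsOpen.inter ?_ ?_
    · exact isOpen_lt (continuous_re.abs) continuous_const
    · exact isOpen_lt continuous_const continuous_im
  have htU : t ∈ U := ⟨by simp [A], half_lt_self ht⟩
  set T : (Fin 2 → ℤ) → ℂ → ℂ := fun x t => 1 / (1 / 2 - (x 0 * t + x 1 : ℂ)) +
    1 / (x 0 * t + x 1 : ℂ) + 1 / 2 / (x 0 * t + x 1 : ℂ) ^ 2 with hT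
  -- The term `x = 0` is the constant `1 / (1/2) = 2`, outside the general bound.
  set u : (Fin 2 → ℤ) → ℝ := fun x => (EisensteinSeries.r ⟨⟨A, B⟩, hB⟩)⁻¹ ^ 3 * ‖x‖ ^ (-3 : ℝ) +
    if x = 0 then 2 else 0 with hu
  have hsum : Summable u :=
    ((EisensteinSeries.summable_one_div_norm_rpow (by norm_num)).mul_left _).add
      (hasSum_ite_eq 0 (2 : ℝ)).summable
  have hne : ∀ x : Fin 2 → ℤ, x ≠ 0 → ∀ w ∈ U, (x 0 * w + x 1 : ℂ) ≠ 0 ∧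
      1 / 2 - (x 0 * w + x 1 : ℂ) ≠ 0 := by
    intro x hx w hw
    have hwim : w.im ≠ 0 := (hB.trans hw.2).ne'
    constructor
    · intro h
      have him := congrArg im h
      have hre := congrArg re h
      simp [hwim] at him
      simp [him] at hre
      exact hx (by ext i; fin_cases i <;> simp [him, hre])
    · intro h
      have him := congrArg im h
      have hre := congrArg re h
      simp [hwim] at him
      simp [him] at hre
      have : (1 : ℝ) = 2 * x 1 := by linarith
      have : (1 : ℤ) = 2 * x 1 := by exact_mod_cast this
      omega
  have hdiff : ∀ x, DifferentiableOn ℂ (T x) U := by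
    intro x
    rcases eq_or_ne x 0 with rfl | hx
    · simp only [hT, Pi.zero_apply, Int.cast_zero, zero_mul]
      fun_prop
    · intro w hw
      obtain ⟨h1, h2⟩ := hne x hx w hw
      have h3 := pow_ne_zero 2 h1
      refine DifferentiableAt.differentiableWithinAt ?_
      simp only [hT]
      fun_prop (disch := assumption)
  have hle : ∀ x, ∀ w ∈ U, ‖T x w‖ ≤ u x := by
    intro x w hw
    rcases eq_or_ne x 0 with rfl | hx
    · simp [hT, hu]
    · have := norm_zetaTerm_half_le hB (τ := ⟨w, hB.trans hw.2⟩) (A := A)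
        ⟨hw.1.le, hw.2.le⟩ hx
      simpa [hT, hu, hx] using this
  have hd := (differentiableOn_tsum_of_summable_norm hsum hdiff hUo hle).const_mul 2
  refine (((hd.congr fun w hw => ?_).differentiableAt (hUo.mem_nhds htU))).differentiableWithinAt
  rw [quasiPeriod_one_eq_tsum, UpperHalfPlane.ofComplex_apply_of_im_pos (hB.trans hw.2)]

theorem isHolomorphic_sigmaPeriodic : IsHolomorphic sigmaPeriodic := by
  have hθ : DifferentiableOn ℂ (fun p : ℂ × ℂ => theta p.1 p.2) {p : ℂ × ℂ | 0 < p.1.im} := by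
    intro p hp
    have h := (hasFDerivAt_jacobiTheta₂ (p.2 + 1 / 2 - p.1 / 2) hp).differentiableAt
    exact (h.comp p (f := fun p : ℂ × ℂ => (p.2 + 1 / 2 - p.1 / 2, p.1))
      (by fun_prop)).differentiableWithinAt
  have hD : DifferentiableOn ℂ (fun p : ℂ × ℂ => thetaDerivQ (exp (2 * Real.pi * I * p.1)))
      {p : ℂ × ℂ | 0 < p.1.im} :=
    differentiableOn_thetaDerivQ.comp (t := Metric.ball 0 1)
      (f := fun p : ℂ × ℂ => exp (2 * Real.pi * I * p.1)) (by fun_prop)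
      fun p hp => mem_ball_zero_iff.2 (norm_exp_two_pi_I_lt_one ⟨p.1, hp⟩)
  have hD0 : ∀ p ∈ {p : ℂ × ℂ | 0 < p.1.im}, thetaDerivQ (exp (2 * Real.pi * I * p.1)) ≠ 0 :=
    fun p hp => thetaDerivQ_ne_zero (mem_ball_zero_iff.2 (norm_exp_two_pi_I_lt_one ⟨p.1, hp⟩))
  refine ((hD.inv hD0).mul hθ).congr fun p hp => ?_
  rw [sigmaPeriodic_eq_theta_div, ← thetaDerivQ_exp,
    UpperHalfPlane.ofComplex_apply_of_im_pos hp]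
  rfl

theorem isHolomorphic_sigma : IsHolomorphic sigma := by
  have hE : DifferentiableOn ℂ (fun p : ℂ × ℂ =>
      quasiPeriod (periods (UpperHalfPlane.ofComplex p.1)).lattice 1) {p : ℂ × ℂ | 0 < p.1.im} :=
    differentiableOn_quasiPeriod_one.comp differentiableOn_fst fun p hp => hp
  have h : DifferentiableOn ℂ (fun p : ℂ × ℂ =>
      exp (1 / 2 * quasiPeriod (periods (UpperHalfPlane.ofComplex p.1)).lattice 1 * p.2 ^ 2 -
        Real.pi * I * p.2) * sigmaPeriodic (UpperHalfPlane.ofComplex p.1) p.2)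
      {p : ℂ × ℂ | 0 < p.1.im} := by
    refine DifferentiableOn.mul ?_ isHolomorphic_sigmaPeriodic
    fun_prop
  exact h.congr fun p _ => sigma_eq_mul_sigmaPeriodic _ _

end Holomorphy

/-! ### Homogeneity under scaling of the lattice -/

section Homogeneity

variable {L L' : PeriodPair} {t : ℂ}

/-- Multiplication by `t` as a bijection `L' ≃ L` when `t L' = L`. -/
def latticeEquivOfMul (ht : t ≠ 0) (h : ∀ w, w ∈ L'.lattice ↔ t * w ∈ L.lattice) :
    L'.lattice ≃ L.lattice where
  toFun w := ⟨t * w, (h w).1 w.2⟩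
  invFun w := ⟨t⁻¹ * w, (h _).2 (by rw [mul_inv_cancel_left₀ ht]; exact w.2)⟩
  left_inv w := Subtype.ext (inv_mul_cancel_left₀ ht _)
  right_inv w := Subtype.ext (mul_inv_cancel_left₀ ht _)

lemma sigmaFactor_mul (ht : t ≠ 0) (z w : ℂ) : sigmaFactor (t * z) (t * w) = sigmaFactor z w := by
  rw [sigmaFactor, mul_div_mul_left _ _ ht, sigmaFactor]

lemma weierstrassSigma_mul (ht : t ≠ 0) (h : ∀ w, w ∈ L'.lattice ↔ t * w ∈ L.lattice) (z : ℂ) :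
    weierstrassSigma L.lattice (t * z) = t * weierstrassSigma L'.lattice z := by
  rw [weierstrassSigma_eq, weierstrassSigma_eq, ← (latticeEquivOfMul ht h).tprod_eq, mul_assoc]
  congr 2
  exact tprod_congr fun w => sigmaFactor_mul ht z w

lemma weierstrassZeta_mul (ht : t ≠ 0) (h : ∀ w, w ∈ L'.lattice ↔ t * w ∈ L.lattice) (z : ℂ) :
    weierstrassZeta L'.lattice z = t * weierstrassZeta L.lattice (t * z) := by
  have h1 : deriv (fun z => weierstrassSigma L.lattice (t * z)) z =
      t * deriv (weierstrassSigma L.lattice) (t * z) := by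
    rw [deriv_comp_mul_left, smul_eq_mul]
  rw [funext (weierstrassSigma_mul ht h),
    deriv_const_mul_field'] at h1
  have h2 := mul_left_cancel₀ ht h1
  rw [weierstrassZeta, weierstrassZeta, weierstrassSigma_mul ht h, ← h2, ← mul_div_assoc,
    mul_div_mul_left _ _ ht]

lemma quasiPeriod_mul (ht : t ≠ 0) (h : ∀ w, w ∈ L'.lattice ↔ t * w ∈ L.lattice) {w : ℂ}
    (hw : w ∈ L'.lattice) : quasiPeriod L'.lattice w = t * quasiPeriod L.lattice (t * w) := by
  refine quasiPeriod_eq_of_forall L' hw fun z hz => ?_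
  rw [weierstrassZeta_mul ht h, weierstrassZeta_mul ht h, mul_add,
    weierstrassZeta_add L ((h w).1 hw) (fun hz' => hz ((h z).2 hz'))]
  ring

lemma weierstrassEta_real_mul (L : PeriodPair) (a : ℝ) (z : ℂ) :
    weierstrassEta L (a * z) = a * weierstrassEta L z := by
  rw [← real_smul]
  simp only [weierstrassEta, map_smul, Finsupp.smul_apply, smul_eq_mul, ofReal_mul]
  ring

/-- The scaled basis of `L'` need not be the chosen basis of `L`; real linearity of `η` and its
agreement with the quasi-periods on the lattice make the choice irrelevant. -/
lemma weierstrassEta_mul (ht : t ≠ 0) (h : ∀ w, w ∈ L'.lattice ↔ t * w ∈ L.lattice) (z : ℂ) :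
    weierstrassEta L' z = t * weierstrassEta L (t * z) := by
  obtain ⟨a, b, rfl⟩ := exists_real_combination L' z
  rw [weierstrassEta_real_combination, quasiPeriod_mul ht h L'.ω₁_mem_lattice,
    quasiPeriod_mul ht h L'.ω₂_mem_lattice,
    ← weierstrassEta_of_mem L ((h _).1 L'.ω₁_mem_lattice),
    ← weierstrassEta_of_mem L ((h _).1 L'.ω₂_mem_lattice),
    show t * (a * L'.ω₁ + b * L'.ω₂) = a * (t * L'.ω₁) + b * (t * L'.ω₂) by ring,
    weierstrassEta_add, weierstrassEta_real_mul, weierstrassEta_real_mul]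
  ring

lemma psi_mul (ht : t ≠ 0) (h : ∀ w, w ∈ L'.lattice ↔ t * w ∈ L.lattice) (z : ℂ) :
    psi L'.lattice z = psi L.lattice (t * z) := by
  unfold psi
  congr 1
  rw [h z, eq_iff_iff, and_congr_right_iff]
  refine fun _ => not_congr ⟨?_, ?_⟩
  · rintro ⟨w, hw, rfl⟩
    exact ⟨t * w, (h w).1 hw, by ring⟩
  · rintro ⟨w, hw, hz⟩
    refine ⟨t⁻¹ * w, (h _).2 (by rwa [mul_inv_cancel_left₀ ht]), mul_left_cancel₀ ht ?_⟩
    rw [hz]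
    field_simp

end Homogeneity

/-! ### Invariance of `σ` and membership in `J` -/

section Modular

variable (M : SL(2, ℤ)) (τ : ℍ)

lemma automorphy_ne_zero : (M 1 0 * τ + M 1 1 : ℂ) ≠ 0 := by
  have := UpperHalfPlane.denom_ne_zero (M : GL (Fin 2) ℝ) τ
  simpa [UpperHalfPlane.denom] using this

lemma automorphy_mul_coe_smul :
    (M 1 0 * τ + M 1 1 : ℂ) * (M • τ : ℍ) = M 0 0 * τ + M 0 1 := by
  rw [UpperHalfPlane.coe_specialLinearGroup_apply]
  simp only [algebraMap_int_eq, Int.coe_castRingHom, ofReal_intCast]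
  exact mul_div_cancel₀ _ (automorphy_ne_zero M τ)

lemma mem_lattice_smul_iff (w : ℂ) : w ∈ (periods (M • τ)).lattice ↔
    (M 1 0 * τ + M 1 1 : ℂ) * w ∈ (periods τ).lattice := by
  have hM := automorphy_mul_coe_smul M τ
  have hdet : (M 0 0 * M 1 1 - M 0 1 * M 1 0 : ℂ) = 1 := by
    have := M.det_coe
    rw [Matrix.det_fin_two] at this
    exact_mod_cast this
  rw [mem_lattice_periods, mem_lattice_periods]
  constructor
  · rintro ⟨m, n, rfl⟩
    refine ⟨m * M 0 0 + n * M 1 0, m * M 0 1 + n * M 1 1, ?_⟩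
    push_cast
    linear_combination -m * hM
  · rintro ⟨m, n, h⟩
    -- The coefficients of the row vector `(m, n)M⁻¹`, integral because the determinant is `1`.
    refine ⟨m * M 1 1 - n * M 1 0, n * M 0 0 - m * M 0 1, ?_⟩
    refine mul_left_cancel₀ (automorphy_ne_zero M τ) ?_
    push_cast
    rw [← h]
    linear_combination (m * M 1 1 - n * M 1 0 : ℂ) * hM + (m * τ + n) * hdet

lemma sigma_smul (z : ℂ) : sigma τ ((M 1 0 * τ + M 1 1 : ℂ) * z) =
    (M 1 0 * τ + M 1 1 : ℂ) * sigma (M • τ) z :=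
  weierstrassSigma_mul (automorphy_ne_zero M τ) (mem_lattice_smul_iff M τ) z

lemma coe_real_smul : (M : SL(2, ℝ)) • τ = M • τ := by
  ext
  rw [UpperHalfPlane.coe_specialLinearGroup_apply, UpperHalfPlane.coe_specialLinearGroup_apply]
  simp

theorem slash'_sigma : slash' (-1) sigma (M : SL(2, ℝ)) = sigma := by
  ext τ z
  have h := automorphy_ne_zero M τ
  have := sigma_smul M τ (z / (M 1 0 * τ + M 1 1 : ℂ))
  rw [mul_div_cancel₀ _ h] at this
  rw [slash', coe_real_smul, this]
  simp

theorem slash''_sigma (a b : ℤ) : slash'' (-1) sigma a b = sigma := by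
  ext τ z
  have hω : (a * τ + b : ℂ) ∈ (periods τ).lattice := (mem_lattice_periods τ).2 ⟨a, b, rfl⟩
  have := weierstrassSigma_add (periods τ) hω z
  rw [slash'', sigma, sigma]
  simp only [ofReal_intCast]
  rw [this, weierstrassEta_of_mem _ hω, zpow_neg_one,
    inv_mul_cancel_left₀ (mul_ne_zero (psi_ne_zero _ _) (exp_ne_zero _))]

theorem sigma_mem_J : sigma ∈ J (-1) (⊤ : Subgroup SL(2, ℤ)) where
  holomorphic := isHolomorphic_sigma
  slash'_eq M _ := slash'_sigma M
  slash''_eq := slash''_sigma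
  fourier M := by
    simp only [slash'_sigma, rho_zpow_neg_one_mul_sigma]
    exact hasFourierDevelopment_sigmaPeriodic

end Modular

/-! ### Klein forms: specialization and transformation laws -/

section Klein

theorem slash''_sigma_zero (a b : ℝ) (τ : ℍ) : slash'' (-1) sigma a b τ 0 = kleinForm a b τ := by
  rw [slash'', kleinForm, zpow_neg_one, mul_inv, psi_inv, ← exp_neg]
  ring_nf

lemma weierstrassEta_periods (a b : ℝ) (τ : ℍ) : weierstrassEta (periods τ) (a * τ + b) =
    quasiPeriod (periods τ).lattice 1 * (a * τ + b) - 2 * Real.pi * I * a := by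
  have := weierstrassEta_real_combination (periods τ) a b
  rw [periods_ω₁, periods_ω₂, mul_one, legendre_relation] at this
  rw [this]
  ring

/-- For `z = aτ + b`, Legendre's relation gives `η(z) = η(1)z - 2πia`, so the terms `½η(1)z²`
cancel. On the lattice both sides vanish, and off it `ψ = 1`. -/
lemma kleinForm_eq (a b : ℝ) (τ : ℍ) : kleinForm a b τ =
    exp (Real.pi * I * (a - 1) * (a * τ + b)) * sigmaPeriodic τ (a * τ + b) := by
  by_cases h : (a * τ + b : ℂ) ∈ (periods τ).lattice
  · rw [(sigmaPeriodic_eq_zero_iff τ).2 h, mul_zero, kleinForm, sigma,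
      (weierstrassSigma_eq_zero_iff _).2 h, mul_zero]
  · have hp : psi (periods τ).lattice (a * τ + b) = 1 := by
      rw [psi, if_neg]
      exact fun h' => h h'.1
    rw [kleinForm, hp, one_mul, weierstrassEta_periods, sigma_eq_mul_sigmaPeriodic, ← mul_assoc,
      ← exp_add]
    congr 2
    ring

lemma mdifferentiable_kleinForm (a b : ℝ) : MDifferentiable 𝓘(ℂ) 𝓘(ℂ) (kleinForm a b) := by
  rw [UpperHalfPlane.mdifferentiable_iff]
  have h1 : DifferentiableOn ℂ (fun t : ℂ => sigmaPeriodic (UpperHalfPlane.ofComplex t) (a * t + b))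
      {t | 0 < t.im} :=
    isHolomorphic_sigmaPeriodic.comp (f := fun t : ℂ => (t, (a * t + b : ℂ))) (by fun_prop)
      fun t ht => ht
  have h2 : DifferentiableOn ℂ (fun t : ℂ => exp (Real.pi * I * (a - 1) * (a * t + b)))
      {t | 0 < t.im} := by fun_prop
  refine (h2.mul h1).congr fun t ht => ?_
  rw [Function.comp_apply, kleinForm_eq, Pi.mul_apply, UpperHalfPlane.ofComplex_apply_of_im_pos ht]

lemma kleinForm_smul (M : SL(2, ℤ)) (a b : ℝ) (τ : ℍ) :
    (M 1 0 * τ + M 1 1 : ℂ) * kleinForm a b (M • τ) =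
      kleinForm (a * M 0 0 + b * M 1 0) (a * M 0 1 + b * M 1 1) τ := by
  have ht := automorphy_ne_zero M τ
  have hL := mem_lattice_smul_iff M τ
  have hz : (M 1 0 * τ + M 1 1 : ℂ) * (a * (M • τ : ℍ) + b) =
      ((a * M 0 0 + b * M 1 0 : ℝ) : ℂ) * τ + ((a * M 0 1 + b * M 1 1 : ℝ) : ℂ) := by
    have := automorphy_mul_coe_smul M τ
    push_cast
    linear_combination a * this
  rw [kleinForm, kleinForm, psi_mul ht hL, weierstrassEta_mul ht hL, ← hz, sigma_smul]
  ring_nf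

lemma kleinForm_slash (M : SL(2, ℤ)) (a b : ℝ) : kleinForm a b ∣[(-1 : ℤ)] M =
    kleinForm (a * M 0 0 + b * M 1 0) (a * M 0 1 + b * M 1 1) := by
  ext τ
  rw [ModularForm.SL_slash_apply, ← kleinForm_smul, mul_comm]
  simp [UpperHalfPlane.denom]

lemma psi_add_two_mul (Λ : Submodule ℤ ℂ) {w : ℂ} (hw : w ∈ Λ) (z : ℂ) :
    psi Λ (z + 2 * w) = psi Λ z := by
  have h2 : 2 * w ∈ Λ := by rw [two_mul]; exact add_mem hw hw
  unfold psi
  congr 1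
  rw [eq_iff_iff, Submodule.add_mem_iff_left _ h2, and_congr_right_iff]
  refine fun _ => not_congr ⟨?_, ?_⟩
  · rintro ⟨v, hv, h⟩
    exact ⟨v - w, sub_mem hv hw, by linear_combination h⟩
  · rintro ⟨v, hv, h⟩
    exact ⟨v + w, add_mem hv hw, by linear_combination h⟩

/-- The translation law of `σ` and Legendre's relation leave the factor `exp(2πi(an - bm))`, trivial
when the exponent's integer condition holds; evenness of the vector keeps `ψ` unchanged. -/
lemma kleinForm_add_even (a b : ℝ) (m n : ℤ) {k : ℤ} (hk : a * n - b * m = k) :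
    kleinForm (a + (2 * m : ℤ)) (b + (2 * n : ℤ)) = kleinForm a b := by
  ext τ
  set z : ℂ := a * τ + b with hz
  set w : ℂ := m * τ + n with hw
  have hwL : w ∈ (periods τ).lattice := (mem_lattice_periods τ).2 ⟨m, n, rfl⟩
  have hwL2 : 2 * w ∈ (periods τ).lattice := by rw [two_mul]; exact add_mem hwL hwL
  have hzw : ((a + (2 * m : ℤ) : ℝ) : ℂ) * τ + ((b + (2 * n : ℤ) : ℝ) : ℂ) = z + 2 * w := by
    rw [hz, hw]; push_cast; ring
  have hψ : psi (periods τ).lattice (2 * w) = 1 := by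
    rw [psi, if_neg]
    rintro ⟨-, h⟩
    exact h ⟨w, hwL, rfl⟩
  have hηz : weierstrassEta (periods τ) z =
      quasiPeriod (periods τ).lattice 1 * z - 2 * Real.pi * I * a := weierstrassEta_periods a b τ
  have hηw : weierstrassEta (periods τ) (2 * w) =
      quasiPeriod (periods τ).lattice 1 * (2 * w) - 2 * Real.pi * I * (2 * m) := by
    have := weierstrassEta_periods (2 * m) (2 * n) τ
    push_cast at this
    rw [show (2 * m * τ + 2 * n : ℂ) = 2 * w by rw [hw]; ring] at this
    exact this
  have hk' : (a * n - b * m : ℂ) = k := by exact_mod_cast hk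
  have hexp : exp (-(1 / 2) * (weierstrassEta (periods τ) z + weierstrassEta (periods τ) (2 * w)) *
      (z + 2 * w)) * exp (weierstrassEta (periods τ) (2 * w) * (z + 1 / 2 * (2 * w))) =
      exp (-(1 / 2) * weierstrassEta (periods τ) z * z) := by
    rw [← exp_add, exp_eq_exp_iff_exists_int]
    refine ⟨k, ?_⟩
    rw [hηz, hηw, ← hk', hz, hw]
    ring
  rw [kleinForm, kleinForm, hzw, psi_add_two_mul _ hwL, weierstrassEta_add, sigma,
    weierstrassSigma_add _ hwL2, hψ, one_mul, ← weierstrassEta_of_mem _ hwL2, ← hz, ← sigma,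
    ← hexp]
  ring

lemma kleinForm_slash_of_mem_Gamma {N : ℕ} (hN : 1 ≤ N) (a b : ℤ) {M : SL(2, ℤ)}
    (hM : M ∈ CongruenceSubgroup.Gamma (2 * N ^ 2)) :
    kleinForm ((a : ℝ) / N) ((b : ℝ) / N) ∣[(-1 : ℤ)] M =
      kleinForm ((a : ℝ) / N) ((b : ℝ) / N) := by
  obtain ⟨h00, h01, h10, h11⟩ := CongruenceSubgroup.Gamma_mem.1 hM
  have key : ∀ x y : ℤ, (x : ZMod (2 * N ^ 2)) = y → ∃ u : ℤ, x = y + 2 * N ^ 2 * u := by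
    intro x y h
    obtain ⟨u, hu⟩ := (ZMod.intCast_eq_intCast_iff_dvd_sub x y _).1 h
    push_cast at hu
    exact ⟨-u, by linear_combination -hu⟩
  obtain ⟨x, hx⟩ := key _ 1 (by simpa using h00)
  obtain ⟨y, hy⟩ := key _ 0 (by simpa using h01)
  obtain ⟨v, hv⟩ := key _ 0 (by simpa using h10)
  obtain ⟨w, hw⟩ := key _ 1 (by simpa using h11)
  have hN0 : (N : ℝ) ≠ 0 := by positivity
  -- For `M = 1 + 2N²U`, the vector `(a, b)/N` moves by `2N(a, b)U`. One factor `N` clears the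
  -- denominator of the vector; the other makes its pairing with the shift integral.
  have := kleinForm_add_even ((a : ℝ) / N) ((b : ℝ) / N) (N * (a * x + b * v))
    (N * (a * y + b * w)) (k := a * (a * y + b * w) - b * (a * x + b * v))
    (by push_cast; field_simp)
  rw [kleinForm_slash, ← this, hx, hy, hv, hw]
  push_cast
  congr 1 <;> field_simp <;> ring

end Klein

/-! ### Laurent expansions at the cusps -/

section Cusps

/-- Regrouping a series `∑ dᵢ Q^(Eᵢ)` with exponents bounded below by `m` as a Laurent series. -/
lemma hasSum_fiberwise_zpow {ι : Type*} {d : ι → ℂ} {E : ι → ℤ} {m : ℤ}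
    (hE : ∀ i, d i ≠ 0 → m ≤ E i) {Q s : ℂ} (h : HasSum (fun i => d i * Q ^ E i) s) :
    HasSum (fun n : ℕ => (∑' i : {i // (E i - m).toNat = n}, d i) * Q ^ (m + n : ℤ)) s := by
  have h1 : HasSum (fun i => d i * Q ^ (m + (E i - m).toNat : ℤ)) s := by
    refine h.congr_fun fun i => ?_
    by_cases hi : d i = 0
    · simp [hi]
    · rw [Int.toNat_of_nonneg (by linarith [hE i hi]), add_sub_cancel]
  have h2 := (Equiv.sigmaFiberEquiv fun i => (E i - m).toNat).hasSum_iff.2 h1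
  refine h2.sigma fun n => ?_
  have h3 : Summable fun i : {i // (E i - m).toNat = n} =>
      d i * Q ^ (m + (E i - m).toNat : ℤ) := h1.summable.subtype {i | (E i - m).toNat = n}
  have h4 := h3.hasSum
  have h5 : (fun i : {i // (E i - m).toNat = n} => d i * Q ^ (m + (E i - m).toNat : ℤ)) =
      fun i : {i // (E i - m).toNat = n} => d i * Q ^ (m + n : ℤ) := by
    ext i
    rw [i.2]
  rw [h5, tsum_mul_right] at h4
  exact h4.congr_fun fun i => congrFun h5 i

/-- For large `n`, `r₀(n) = o(n)` lets `Nn` outweigh `|A|r₀(n)`; for the finitely many smaller `n`,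
monotonicity bounds `r₀(n)`. -/
lemma exists_lower_bound_exponent {r₀ : ℕ → ℕ} (hmono : Monotone r₀)
    (hlim : Tendsto (fun n : ℕ => (r₀ n : ℝ) / (n : ℝ)) atTop (𝓝 0)) {N : ℕ} (hN : 1 ≤ N) (A : ℤ) :
    ∃ m : ℤ, ∀ (n : ℕ) (r : ℤ), |r| ≤ r₀ n → m ≤ N * n + A * r := by
  have hpos : (0 : ℝ) < 1 / (|A| + 1 : ℤ) := by positivity
  obtain ⟨n₀, hn₀⟩ := eventually_atTop.1
    ((hlim.eventually_lt_const hpos).and (eventually_gt_atTop 0))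
  refine ⟨-(|A| * r₀ n₀), fun n r hr => ?_⟩
  have hAr : -(|A| * |r|) ≤ A * r := by rw [← abs_mul]; exact neg_abs_le _
  have hA : 0 ≤ |A| := abs_nonneg A
  have hNn : (n : ℤ) ≤ N * n := by
    have : (1 : ℤ) ≤ N := by exact_mod_cast hN
    nlinarith
  have hprod : |A| * |r| ≤ |A| * r₀ n := mul_le_mul_of_nonneg_left hr hA
  rcases le_total n₀ n with h | h
  · obtain ⟨h1, h2⟩ := hn₀ n h
    have h2' : (0 : ℝ) < n := by exact_mod_cast h2
    rw [div_lt_div_iff₀ h2' (by positivity), one_mul] at h1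
    have h3 : (r₀ n : ℤ) * (|A| + 1) < n := by exact_mod_cast h1
    have h4 : (0 : ℤ) ≤ |A| * r₀ n₀ := by positivity
    nlinarith
  · have : (r₀ n : ℤ) ≤ r₀ n₀ := by exact_mod_cast hmono h
    have := mul_le_mul_of_nonneg_left this hA
    have h5 : (0 : ℤ) ≤ N * n := by positivity
    linarith

theorem exists_hasSum_kleinForm {N : ℕ} (hN : 1 ≤ N) (A B : ℤ) :
    ∃ (h : ℕ) (m : ℤ) (a : ℕ → ℂ), 0 < h ∧ ∀ τ : ℍ,
      HasSum (fun n : ℕ => a n * exp (2 * Real.pi * I * τ / h) ^ (m + n : ℤ))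
        (kleinForm ((A : ℝ) / N) ((B : ℝ) / N) τ) := by
  obtain ⟨r₀, c, hmono, hlim, hc, hsum⟩ := hasFourierDevelopment_sigmaPeriodic
  have hN0 : (N : ℂ) ≠ 0 := by exact_mod_cast (by omega : N ≠ 0)
  obtain ⟨m, hm⟩ := exists_lower_bound_exponent hmono hlim (N := 2 * N ^ 2) (by nlinarith)
    (2 * N * A)
  set d : ℕ × ℤ → ℂ := fun p => exp (Real.pi * I * (A / N - 1) * (B / N)) * c p.1 p.2 *
    exp (2 * Real.pi * I * (B / N)) ^ p.2 with hd
  -- Exponents of `exp(2πiτ/(2N²))`: the prefactor of `kleinForm_eq` gives `(A - N)A`, `qⁿ` gives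
  -- `2N²n`, and `exp(2πirz)` at `z = (Aτ + B)/N` gives `2NAr`.
  set E : ℕ × ℤ → ℤ := fun p => (A - N) * A + ((2 * N ^ 2 : ℕ) * p.1 + 2 * N * A * p.2) with hEdef
  have hE : ∀ p, d p ≠ 0 → (A - N) * A + m ≤ E p := by
    intro p hp
    refine add_le_add_right (hm p.1 p.2 ?_) _
    by_contra! hlt
    exact hp (by simp [hd, hc p.1 p.2 hlt])
  refine ⟨2 * N ^ 2, (A - N) * A + m, _, by positivity, fun τ =>
    hasSum_fiberwise_zpow (d := d) (E := E) hE ?_⟩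
  have h1 := (hsum τ (A / N * τ + B / N)).mul_left
    (exp (Real.pi * I * (A / N - 1) * (A / N * τ + B / N)))
  rw [kleinForm_eq]
  push_cast
  refine h1.congr_fun fun p => ?_
  rw [hd, hEdef]
  simp only [← exp_int_mul, ← exp_nat_mul]
  have : ∀ x y z w u v : ℂ, x + y + z = w + u + v →
      exp x * (c p.1 p.2 * exp y * exp z) = exp w * c p.1 p.2 * exp u * exp v := by
    intro x y z w u v h
    have : exp x * exp y * exp z = exp w * exp u * exp v := by
      rw [← exp_add, ← exp_add, ← exp_add, ← exp_add, h]
    linear_combination c p.1 p.2 * this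
  refine (this _ _ _ _ _ _ ?_).symm
  push_cast
  field_simp
  ring

theorem isNearlyHolomorphicModularForm_kleinForm {N : ℕ} (hN : 1 ≤ N) (a b : ℤ) :
    IsNearlyHolomorphicModularForm (-1) (CongruenceSubgroup.Gamma (2 * N ^ 2))
      (kleinForm ((a : ℝ) / N) ((b : ℝ) / N)) where
  holomorphic := mdifferentiable_kleinForm _ _
  slash_eq _ hM := kleinForm_slash_of_mem_Gamma hN a b hM
  meromorphic_at_cusps M := by
    -- The slash by `M` is again a Klein form with index in `N⁻¹ℤ²`, so the expansion at infinity
    -- covers every cusp.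
    have h1 : (a : ℝ) / N * M 0 0 + b / N * M 1 0 = ((a * M 0 0 + b * M 1 0 : ℤ) : ℝ) / N := by
      push_cast; ring
    have h2 : (a : ℝ) / N * M 0 1 + b / N * M 1 1 = ((a * M 0 1 + b * M 1 1 : ℤ) : ℝ) / N := by
      push_cast; ring
    rw [kleinForm_slash, h1, h2]
    exact exists_hasSum_kleinForm hN _ _

end Cusps

end ModifiedJacobi

end

theorem theorem3p4 :
    -- the Weierstrass product converges, and `η` is the additive quasi-period of `ζ`
    ((∀ (τ : ℍ) (z : ℂ), Multipliable
        fun ω : ↥(((ModifiedJacobi.periods τ).lattice : Set ℂ) \ {0}) =>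
          ModifiedJacobi.sigmaFactor z ω) ∧
      (∀ (τ : ℍ), ∀ ω ∈ (ModifiedJacobi.periods τ).lattice,
        ∀ z ∉ (ModifiedJacobi.periods τ).lattice,
          ModifiedJacobi.weierstrassZeta (ModifiedJacobi.periods τ).lattice (z + ω) =
            ModifiedJacobi.weierstrassZeta (ModifiedJacobi.periods τ).lattice z +
              ModifiedJacobi.weierstrassEta (ModifiedJacobi.periods τ) ω)) ∧
    -- `σ(τ, z)` is a modified Jacobi form of weight `-1` and index `0` on `SL₂(ℤ)`
    ModifiedJacobi.sigma ∈ ModifiedJacobi.J (-1) (⊤ : Subgroup SL(2, ℤ)) ∧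
    -- the Klein forms are its specializations, and they are nearly holomorphic modular forms
    (∀ (a b : ℝ) (τ : ℍ),
      ModifiedJacobi.slash'' (-1) ModifiedJacobi.sigma a b τ 0 =
        ModifiedJacobi.kleinForm a b τ) ∧
    (∀ (N : ℕ), 1 ≤ N → ∀ a b : ℤ,
      ModifiedJacobi.IsNearlyHolomorphicModularForm (-1) (CongruenceSubgroup.Gamma (2 * N ^ 2))
        (ModifiedJacobi.kleinForm ((a : ℝ) / N) ((b : ℝ) / N))) :=
  ⟨⟨fun τ z => ModifiedJacobi.multipliable_sigmaFactor _ z, fun τ ω hω z hz => by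
      rw [ModifiedJacobi.weierstrassEta_of_mem _ hω]
      exact ModifiedJacobi.weierstrassZeta_add _ hω hz⟩,
    ModifiedJacobi.sigma_mem_J, ModifiedJacobi.slash''_sigma_zero,
    fun _ hN a b => ModifiedJacobi.isNearlyHolomorphicModularForm_kleinForm hN a b⟩
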